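/- Let $m\ge 2$ be an integer, let $\delta_k=+1$ for $0\le k\le\lfloor m/4\rfloor$ and for $m-\lfloor m/4\rfloor\le k\le m$, and $\delta_k=-1$ for $\lfloor m/4\rfloor<k<m-\lfloor m/4\rfloor$. Let $(\delta_n)_{n\ge0}$ be the $(+1,\delta_1,\dots,\delta_m)$-Thue-Morse sequence, that is, the unique fixed point beginning with $+1$ of the morphism $+1\mapsto +1,+\delta_1,\dots,+\delta_m$, $\ -1\mapsto -1,-\delta_1,\dots,-\delta_m$. Put $$p(n)=\sum_{k=0}^{n-1}\delta_k e^{2k\pi i/m}\quad(n\ge 0),\qquad P(n)=\bigcup_{k=1}^{(m+1)^n}[p(k-1),p(k)],$$ where $[z,w]$ is the segment from $z$ to $w$ in $\mathbb{C}$, and, when $p(m+1)\ne0$, $$S_j(z)=\frac{p(j)+\delta_j e^{2j\pi i/m}z}{p(m+1)}\qquad(z\in\mathbb{C},\ 0\le j\le m).$$ Then: 1. $p(m+1)$ is a real number in $[3,m+1]$. 2. The family $\{S_j\}_{0\le j\le m}$ satisfies the open set condition: there is a non-empty bounded open set $V\subset\mathbb{C}$ such that the sets $S_0(V),\dots,S_m(V)$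 are pairwise disjoint and contained in $V$. 3. There is a unique non-empty compact set $K\subset\mathbb{C}$ (the $(+1,\delta_1,\dots,\delta_m)$-Koch curve) to which the sets $p(m+1)^{-n}P(n)$ converge in the Hausdorff metric as $n\to\infty$, and the Hausdorff dimension, the packing dimension and the box dimension of $K$ (the latter meaning that the lower and upper box dimensions coincide) are all equal to $\log(m+1)/\log p(m+1)$. -/

import Mathlib

open Filter Topology
open scoped NNReal ENNReal

namespace KochCurve

/-! ### Generalized Thue-Morse sequences

The alphabet `{+1, -1}` is the type `ℤˣ`, and a block `d : Fin (m + 1) → ℤˣ` stands for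
`(d 0, d 1, …, d m)`. -/

/-- The image of the letter `a` under the morphism
`+1 ↦ d 0, …, d m` and `-1 ↦ - d 0, …, - d m`. -/
def letterImage {m : ℕ} (d : Fin (m + 1) → ℤˣ) (a : ℤˣ) : List ℤˣ :=
  List.ofFn fun k => a * d k

/-- The morphism of the free monoid of words over `{+1, -1}` determined by the block `d`. -/
def morphism {m : ℕ} (d : Fin (m + 1) → ℤˣ) (w : List ℤˣ) : List ℤˣ :=
  w.flatMap (letterImage d)

/-- The word `δ 0, …, δ (n - 1)`. -/
def initialWord (δ : ℕ → ℤˣ) (n : ℕ) : List ℤˣ := (List.range n).map δ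

/-- `δ` is the `(d 0, …, d m)`-Thue-Morse sequence: it begins with `+1` and it is a fixed point
of the morphism, i.e. the image of each of its initial words (a word that is `m + 1` times as long)
is again an initial word of `δ`. -/
def IsThueMorse {m : ℕ} (d : Fin (m + 1) → ℤˣ) (δ : ℕ → ℤˣ) : Prop :=
  δ 0 = 1 ∧ ∀ n : ℕ, morphism d (initialWord δ n) = initialWord δ ((m + 1) * n)

/-- The block `(δ_0, …, δ_m)` with `δ_k = +1` for `k ≤ ⌊m/4⌋` and for `k ≥ m - ⌊m/4⌋`, and
`δ_k = -1` otherwise. -/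
def quarterBlock (m : ℕ) (k : Fin (m + 1)) : ℤˣ :=
  if (k : ℕ) ≤ m / 4 ∨ m - m / 4 ≤ (k : ℕ) then 1 else -1

/-! ### The points, the polygonal lines, the limit curve and the maps -/

/-- The unit vector `δ_k e^{2kπi/m}`. -/
noncomputable def step (m : ℕ) (δ : ℕ → ℤˣ) (k : ℕ) : ℂ :=
  ((δ k : ℤ) : ℂ) * Complex.exp (2 * (k : ℂ) * (Real.pi : ℂ) * Complex.I / (m : ℂ))

/-- `p(n) = ∑_{k < n} δ_k e^{2kπi/m}`. -/
noncomputable def p (m : ℕ) (δ : ℕ → ℤˣ) (n : ℕ) : ℂ :=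
  ∑ k ∈ Finset.range n, step m δ k

/-- `P(n)`, the polygonal line through `p(0), p(1), …, p((m+1)^n)`. -/
def polygon (m : ℕ) (δ : ℕ → ℤˣ) (n : ℕ) : Set ℂ :=
  ⋃ k ∈ Finset.Icc 1 ((m + 1) ^ n), segment ℝ (p m δ (k - 1)) (p m δ k)

/-- `K` is the generalized Koch curve: the (non-empty) compact set to which the rescaled polygonal
lines `p(m+1)^{-n} P(n)` converge in the Hausdorff metric. -/
def IsKochCurve (m : ℕ) (δ : ℕ → ℤˣ) (K : Set ℂ) : Prop :=
  K.Nonempty ∧ IsCompact K ∧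
    Tendsto
      (fun n : ℕ =>
        Metric.hausdorffEDist ((fun z : ℂ => (p m δ (m + 1) ^ n)⁻¹ * z) '' polygon m δ n) K)
      atTop (𝓝 0)

/-- The maps `S_j(z) = (p(j) + δ_j e^{2jπi/m} z) / p(m+1)`, `0 ≤ j ≤ m`, of the iterated function
system. -/
noncomputable def ifs (m : ℕ) (δ : ℕ → ℤˣ) (j : Fin (m + 1)) (z : ℂ) : ℂ :=
  (p m δ j + step m δ j * z) / p m δ (m + 1)

/-- The open set condition: there is a non-empty bounded open set `V` such that the sets `S_j(V)`
are pairwise disjoint and contained in `V`. -/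
def OpenSetCondition {ι : Type*} (S : ι → ℂ → ℂ) : Prop :=
  ∃ V : Set ℂ, V.Nonempty ∧ Bornology.IsBounded V ∧ IsOpen V ∧
    (⋃ j, S j '' V) ⊆ V ∧ Pairwise fun i j => Disjoint (S i '' V) (S j '' V)

/-! ### Packing dimension and box dimension of subsets of the plane -/

/-- A finite family of (centre, radius) pairs that describes pairwise disjoint closed balls with
centres in `F` and with radii in `(0, ε]`. -/
def IsBallPacking (F : Set ℂ) (ε : ℝ) (t : Finset (ℂ × ℝ)) : Prop :=
  (∀ b ∈ t, b.1 ∈ F ∧ 0 < b.2 ∧ b.2 ≤ ε) ∧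
    (t : Set (ℂ × ℝ)).Pairwise fun b c =>
      Disjoint (Metric.closedBall b.1 b.2) (Metric.closedBall c.1 c.2)

/-- The supremum of `∑ |B_i|^s` over packings of `F` by disjoint balls `B_i` of radii at most `ε`;
`|B_i|`, the diameter of the ball, is twice its radius. (Countable packings give the same
supremum.) -/
noncomputable def packingPremeasureAt (s : ℝ≥0) (ε : ℝ) (F : Set ℂ) : ℝ≥0∞ :=
  ⨆ (t : Finset (ℂ × ℝ)) (_ : IsBallPacking F ε t),
    ∑ b ∈ t, ENNReal.ofReal ((2 * b.2) ^ (s : ℝ))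

/-- The `s`-dimensional packing premeasure, the limit of the above as `ε` decreases to `0`. -/
noncomputable def packingPremeasure (s : ℝ≥0) (F : Set ℂ) : ℝ≥0∞ :=
  ⨅ (ε : ℝ) (_ : 0 < ε), packingPremeasureAt s ε F

/-- The `s`-dimensional packing (outer) measure. -/
noncomputable def packingMeasure (s : ℝ≥0) (F : Set ℂ) : ℝ≥0∞ :=
  ⨅ (A : ℕ → Set ℂ) (_ : F ⊆ ⋃ i, A i), ∑' i, packingPremeasure s (A i)

/-- The packing dimension: the supremum of all `s` for which the packing measure is infinite. -/
noncomputable def packingDim (F : Set ℂ) : ℝ≥0∞ :=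
  ⨆ (s : ℝ≥0) (_ : packingMeasure s F = ∞), (s : ℝ≥0∞)

/-- The non-empty bounded set `F` has box dimension `s`: if `N_ε(F)` is the least number of closed
balls of radius `ε` that cover `F`, then `log N_ε(F) / (- log ε)` tends to `s` as `ε ↓ 0`
(so that the lower and the upper box dimension are both equal to `s`). -/
def HasBoxDim (F : Set ℂ) (s : ℝ) : Prop :=
  F.Nonempty ∧ Bornology.IsBounded F ∧
    Tendsto
      (fun ε : ℝ≥0 =>
        Real.log ((Metric.externalCoveringNumber ε F).toNat : ℝ) / (-Real.log (ε : ℝ)))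
      (𝓝[>] 0) (𝓝 s)

/-! ### Existence and uniqueness of the Thue-Morse sequence -/

theorem isThueMorse_iff {m : ℕ} (d : Fin (m + 1) → ℤˣ) (δ : ℕ → ℤˣ) :
    IsThueMorse d δ ↔
      δ 0 = 1 ∧ ∀ (r : ℕ) (k : Fin (m + 1)), δ ((m + 1) * r + k) = δ r * d k := by
  have key : ∀ n, initialWord δ ((m + 1) * (n + 1)) =
      initialWord δ ((m + 1) * n) ++
        List.ofFn (fun k : Fin (m + 1) => δ ((m + 1) * n + k)) := by
    intro n
    rw [initialWord, initialWord, Nat.mul_succ, List.range_add, List.map_append]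
    congr 1
    apply List.ext_getElem
    · simp
    · intro i h1 h2
      simp [-List.ofFn_succ]
  have key2 : ∀ n, morphism d (initialWord δ (n + 1)) =
      morphism d (initialWord δ n) ++ letterImage d (δ n) := by
    intro n
    simp [morphism, initialWord, List.range_succ]
  unfold IsThueMorse
  refine and_congr_right fun _ => ⟨fun h r k => ?_, fun h n => ?_⟩
  · have h1 := h (r + 1)
    rw [key2, key, h r] at h1
    have h2 := List.append_cancel_left h1
    exact (congrFun (List.ofFn_injective h2) k).symm
  · induction n with
    | zero => simp [morphism, initialWord]
    | succ n ih =>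
      rw [key2, key, ih]
      congr 1
      unfold letterImage
      congr 1
      funext k
      exact (h n k).symm

/-- If the block begins with `+1` (and has at least two letters), the corresponding Thue-Morse
sequence exists and is unique. -/
theorem existsUnique_isThueMorse {m : ℕ} (hm : 1 ≤ m) (d : Fin (m + 1) → ℤˣ) (hd : d 0 = 1) :
    ∃! δ : ℕ → ℤˣ, IsThueMorse d δ := by
  have hm0 : 0 < m + 1 := Nat.succ_pos m
  refine ⟨fun n => ((Nat.digits (m + 1) n).map fun a => d (Fin.ofNat (m + 1) a)).prod, ?_, ?_⟩
  · refine (isThueMorse_iff d _).2 ?_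
    refine ⟨by simp, fun r k => ?_⟩
    by_cases h0 : (k : ℕ) = 0 ∧ r = 0
    · obtain ⟨hk, rfl⟩ := h0
      have : k = 0 := Fin.ext hk
      subst this
      simp [hd]
    · have hdig : Nat.digits (m + 1) ((m + 1) * r + k) = (k : ℕ) :: Nat.digits (m + 1) r := by
        rw [add_comm ((m + 1) * r)]
        exact Nat.digits_add (m + 1) (by omega) k r k.isLt (by omega)
      have hk : Fin.ofNat (m + 1) (k : ℕ) = k := Fin.ext (Nat.mod_eq_of_lt k.isLt)
      simp only [hdig, List.map_cons, List.prod_cons, hk]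
      exact mul_comm _ _
  · intro δ hδ
    rw [isThueMorse_iff] at hδ
    obtain ⟨h0, h⟩ := hδ
    funext n
    induction n using Nat.strong_induction_on with
    | _ n ih =>
      rcases Nat.eq_zero_or_pos n with rfl | hn
      · simp [h0]
      · have hlt : n / (m + 1) < n := Nat.div_lt_self hn (by omega)
        have h1 := h (n / (m + 1)) ⟨n % (m + 1), Nat.mod_lt _ hm0⟩
        have h2 : (m + 1) * (n / (m + 1)) + n % (m + 1) = n := Nat.div_add_mod n (m + 1)
        simp only [h2] at h1
        rw [h1, ih _ hlt]
        conv_rhs => rw [Nat.digits_def' (by omega) hn]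
        simp only [List.map_cons, List.prod_cons]
        rw [mul_comm]
        congr 2
        exact Fin.ext (Nat.mod_mod _ _).symm

end KochCurve

namespace KochCurve

/-! Write N = m + 1, x = p(N), and let s be the exponent with x^s = N. Since N r is congruent to r
modulo m, `step` is multiplicative under r ↦ N r + k for 0 ≤ k ≤ m. Hence p(N r + k) = x p(r) +
step(r) p(k) (`p_mul_add`): the vertices of level n + 1 arise by replacing each edge of level n with
a scaled copy of the first polygonal line. The rescaled vertices with a given N-adic address
therefore converge geometrically, and the limits parametrize the curve K by [0, 1).

The dimensions come from one measure, the image of Lebesgue measure under this parametrization. An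
address interval of level n has mass N^(-n) and its image has size of order x^(-n), so balls of
radius r about points of K have mass at least c r^s. The open set condition gives the converse bound
C r^s: disjoint copies of a ball inside V allow only boundedly many vertices of level n near a point
(`exists_card_vertex_le`). Such two-sided bounds determine the Hausdorff, packing and box dimensions
by comparing masses of balls in packings and covers.

The geometric core is the open set condition. The sign pattern splits the edges 0, …, m into three
arcs, each running along a regular m-gon of side 1. The set V is the interior of the isosceles
triangle spanned by the edge [0, 1] and the centre of the m-gon on it, so that its copies along an
arc are sectors of one m-gon. Copies on one arc are separated by lines through the common centre,
and copies on different arcs by the vertical lines through the junctions of the arcs. The union of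
all copies must also fit into the triangle enlarged by x. It does unless m ≡ 3 mod 4; then the
middle arc dips below the base, and a fourth corner on the circumcircle turns the triangle into a
kite. All angles are multiples of π/(2m), and `sn_le` reduces the inequalities between their sines
to linear arithmetic of integers. For m = 2 the triangle is degenerate and a rectangle takes its
place. -/

open MeasureTheory Metric

/-! ### Ahlfors regular measures and ball packings -/

/-- The probability measure `μ` is supported by `K`, and the measure of a small ball is comparable
to the `s`-th power of its radius. -/
structure IsAhlforsRegular (μ : Measure ℂ) (K : Set ℂ) (s c C : ℝ) : Prop where
  c_pos : 0 < c
  C_pos : 0 < C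
  s_pos : 0 < s
  measure_univ : μ Set.univ = 1
  compl_null : μ Kᶜ = 0
  lower : ∀ z ∈ K, ∀ r : ℝ, 0 < r → r ≤ 1 → ENNReal.ofReal (c * r ^ s) ≤ μ (closedBall z r)
  upper : ∀ z : ℂ, ∀ r : ℝ, 0 < r → r ≤ 1 → μ (closedBall z r) ≤ ENNReal.ofReal (C * r ^ s)

/-- A bounded set contains a finite separated set whose points are the centres of a cover. -/
theorem exists_separated_cover {A : Set ℂ} (hA : TotallyBounded A) {ε : ℝ} (hε : 0 < ε) :
    ∃ t : Finset ℂ, (t : Set ℂ) ⊆ A ∧ (t : Set ℂ).Pairwise (fun y z => 2 * ε < dist y z) ∧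
      A ⊆ ⋃ y ∈ t, closedBall y (2 * ε) := by
  lift ε to ℝ≥0 using hε.le
  have hε' : ε ≠ 0 := by
    rintro rfl
    simp at hε
  have hfin : packingNumber (2 * ε) A ≠ ⊤ := by
    obtain ⟨N, -, hN, hcov⟩ := exists_finite_isCover_of_totallyBounded hε' hA
    have h1 := (packingNumber_two_mul_le_externalCoveringNumber ε A).trans
      hcov.externalCoveringNumber_le_encard
    exact (h1.trans_lt hN.encard_lt_top).ne
  have hf : (maximalSeparatedSet (2 * ε) A).Finite := by
    rw [← Set.encard_ne_top_iff, encard_maximalSeparatedSet hfin]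
    exact hfin
  refine ⟨hf.toFinset, by simpa using maximalSeparatedSet_subset, ?_, ?_⟩
  · intro y hy z hz hyz
    have h : ((2 * ε : ℝ≥0) : ℝ≥0∞) < edist y z :=
      isSeparated_maximalSeparatedSet (by simpa using hy) (by simpa using hz) hyz
    rw [edist_dist, ← ENNReal.ofReal_coe_nnreal] at h
    have h2 := (ENNReal.ofReal_lt_ofReal_iff_of_nonneg (by positivity)).1 h
    simpa using h2
  · have h := isCover_iff_subset_iUnion_closedBall.1 (isCover_maximalSeparatedSet hfin)
    simpa using h

/-- The point `y`, as the centre of a ball of radius `ε`. -/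
def withRadius (ε : ℝ) : ℂ ↪ ℂ × ℝ :=
  ⟨fun y => (y, ε), fun _ _ h => (Prod.ext_iff.1 h).1⟩

@[simp]
theorem withRadius_apply (ε : ℝ) (y : ℂ) : withRadius ε y = (y, ε) := rfl

namespace IsAhlforsRegular

variable {μ : Measure ℂ} {K : Set ℂ} {s c C : ℝ}

/-- The masses of disjoint balls add up to at most `1`. -/
theorem sum_le_one (h : IsAhlforsRegular μ K s c C) {ε : ℝ} (hε : ε ≤ 1) {t : Finset (ℂ × ℝ)}
    (ht : IsBallPacking K ε t) : ∑ b ∈ t, ENNReal.ofReal (c * b.2 ^ s) ≤ 1 := by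
  calc ∑ b ∈ t, ENNReal.ofReal (c * b.2 ^ s) ≤ ∑ b ∈ t, μ (closedBall b.1 b.2) :=
        Finset.sum_le_sum fun b hb =>
          h.lower _ (ht.1 b hb).1 _ (ht.1 b hb).2.1 ((ht.1 b hb).2.2.trans hε)
    _ = μ (⋃ b ∈ t, closedBall b.1 b.2) :=
        (measure_biUnion_finset (fun b hb b' hb' hne => ht.2 hb hb' hne)
          (fun b _ => isClosed_closedBall.measurableSet)).symm
    _ ≤ 1 := h.measure_univ ▸ measure_mono (Set.subset_univ _)

theorem isBallPacking_of_separated {A : Set ℂ} {ε : ℝ} (hε : 0 < ε) {t : Finset ℂ}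
    (htA : (t : Set ℂ) ⊆ A) (hsep : (t : Set ℂ).Pairwise (fun y z => 2 * ε < dist y z)) :
    IsBallPacking A ε (t.map (withRadius ε)) := by
  constructor
  · intro b hb
    obtain ⟨y, hy, rfl⟩ := Finset.mem_map.1 hb
    exact ⟨htA hy, hε, le_rfl⟩
  · intro b hb b' hb' hne
    obtain ⟨y, hy, rfl⟩ := Finset.mem_map.1 hb
    obtain ⟨z, hz, rfl⟩ := Finset.mem_map.1 hb'
    have : y ≠ z := fun h => hne (by rw [h])
    apply closedBall_disjoint_closedBall
    have := hsep hy hz this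
    change ε + ε < dist y z
    linarith

theorem card_mul_le_one (h : IsAhlforsRegular μ K s c C) {ε : ℝ} (hε0 : 0 < ε) (hε : ε ≤ 1)
    {t : Finset ℂ} (htA : (t : Set ℂ) ⊆ K)
    (hsep : (t : Set ℂ).Pairwise (fun y z => 2 * ε < dist y z)) :
    (t.card : ℝ) * (c * ε ^ s) ≤ 1 := by
  have hc := h.c_pos
  have h1 := h.sum_le_one hε (isBallPacking_of_separated hε0 htA hsep)
  rw [Finset.sum_map] at h1
  simp only [withRadius_apply, Finset.sum_const, nsmul_eq_mul] at h1
  rw [← ENNReal.ofReal_natCast, ← ENNReal.ofReal_mul (by positivity), ENNReal.ofReal_le_one] at h1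
  exact h1

theorem le_card_mul (h : IsAhlforsRegular μ K s c C) {A : Set ℂ} {ε : ℝ} (hε0 : 0 < ε) (hε : ε ≤ 1)
    {t : Finset ℂ} (hcov : A ⊆ ⋃ y ∈ t, closedBall y ε) :
    μ A ≤ ENNReal.ofReal ((t.card : ℝ) * (C * ε ^ s)) := by
  calc μ A ≤ μ (⋃ y ∈ t, closedBall y ε) := measure_mono hcov
    _ ≤ ∑ y ∈ t, μ (closedBall y ε) := measure_biUnion_finset_le _ _
    _ ≤ ∑ y ∈ t, ENNReal.ofReal (C * ε ^ s) := Finset.sum_le_sum fun y _ => h.upper y ε hε0 hε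
    _ = ENNReal.ofReal ((t.card : ℝ) * (C * ε ^ s)) := by
        rw [Finset.sum_const, nsmul_eq_mul, ENNReal.ofReal_mul (Nat.cast_nonneg _),
          ENNReal.ofReal_natCast]

theorem measure_eq_one (h : IsAhlforsRegular μ K s c C) : μ K = 1 := by
  have h1 : μ K = μ Set.univ := measure_congr (by
    rw [eventuallyEq_univ]
    exact mem_ae_iff.2 h.compl_null)
  rw [h1, h.measure_univ]

theorem nonempty (h : IsAhlforsRegular μ K s c C) : K.Nonempty := by
  rw [Set.nonempty_iff_ne_empty]
  rintro rfl
  have := h.measure_eq_one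
  simp at this

/-! ### Box dimension -/

theorem toNat_covering_le (h : IsAhlforsRegular μ K s c C) (hK : TotallyBounded K) {ε : ℝ≥0}
    (hε0 : 0 < ε) (hε : ε ≤ 1) :
    ((externalCoveringNumber ε K).toNat : ℝ) ≤ 2 ^ s / c * (ε : ℝ) ^ (-s) := by
  have hc := h.c_pos
  have hε' : (0 : ℝ) < ε := hε0
  have hε1 : (ε : ℝ) ≤ 1 := hε
  obtain ⟨t, htK, hsep, hcov⟩ := exists_separated_cover hK (half_pos hε')
  have hcard := h.card_mul_le_one (half_pos hε') (by linarith) htK hsep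
  have hN : externalCoveringNumber ε K ≤ (t.card : ℕ∞) := by
    rw [← Set.encard_coe_eq_coe_finsetCard]
    refine IsCover.externalCoveringNumber_le_encard (isCover_iff_subset_iUnion_closedBall.2 ?_)
    rw [mul_div_cancel₀ _ (two_ne_zero)] at hcov
    simpa using hcov
  have h2 : (externalCoveringNumber ε K).toNat ≤ t.card := by
    simpa using ENat.toNat_le_toNat hN (by simp)
  have h3 : ((externalCoveringNumber ε K).toNat : ℝ) ≤ t.card := by exact_mod_cast h2
  refine h3.trans ?_
  have h4 : ((ε : ℝ) / 2) ^ s = (2 ^ s * (ε : ℝ) ^ (-s))⁻¹ := by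
    rw [Real.div_rpow hε'.le (by norm_num), Real.rpow_neg hε'.le]
    field_simp
  rw [h4] at hcard
  have hp : 0 < 2 ^ s * (ε : ℝ) ^ (-s) := by positivity
  rw [div_mul_eq_mul_div, le_div_iff₀ hc]
  rw [← div_eq_mul_inv, mul_div_assoc', div_le_one hp] at hcard
  exact hcard

theorem le_toNat_covering (h : IsAhlforsRegular μ K s c C) (hK : TotallyBounded K) {ε : ℝ≥0}
    (hε0 : 0 < ε) (hε : ε ≤ 1) :
    1 / C * (ε : ℝ) ^ (-s) ≤ ((externalCoveringNumber ε K).toNat : ℝ) := by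
  have hC := h.C_pos
  have hε' : (0 : ℝ) < ε := hε0
  have hε1 : (ε : ℝ) ≤ 1 := hε
  have hle : ((⌈1 / C * (ε : ℝ) ^ (-s)⌉₊ : ℕ) : ℕ∞) ≤ externalCoveringNumber ε K := by
    refine le_iInf₂ fun N hN => ?_
    rcases N.finite_or_infinite with hf | hf
    · lift N to Finset ℂ using hf
      rw [Set.encard_coe_eq_coe_finsetCard, Nat.cast_le, Nat.ceil_le]
      have h1 := h.le_card_mul hε' hε1
        (by simpa using isCover_iff_subset_iUnion_closedBall.1 hN)
      rw [h.measure_eq_one, ENNReal.one_le_ofReal] at h1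
      have hp : 0 < (ε : ℝ) ^ s := by positivity
      rw [Real.rpow_neg hε'.le, ← one_div, div_mul_div_comm, one_mul, div_le_iff₀ (by positivity)]
      exact h1
    · rw [hf.encard_eq]
      exact le_top
  -- `ENat.toNat` sends `⊤` to `0`, so the lower bound passes to natural numbers only once the
  -- covering number is known to be finite.
  have htop : externalCoveringNumber ε K ≠ ⊤ := by
    obtain ⟨N, -, hN, hcov⟩ := exists_finite_isCover_of_totallyBounded hε0.ne' hK
    exact (hcov.externalCoveringNumber_le_encard.trans_lt hN.encard_lt_top).ne
  have h2 := ENat.toNat_le_toNat hle htop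
  rw [ENat.toNat_natCast] at h2
  exact (Nat.le_ceil _).trans (by exact_mod_cast h2)

theorem hasBoxDim (h : IsAhlforsRegular μ K s c C) (hK : IsCompact K) : HasBoxDim K s := by
  have hc := h.c_pos
  have hC := h.C_pos
  refine ⟨h.nonempty, hK.isBounded, ?_⟩
  have hlog : Tendsto (fun ε : ℝ≥0 => -Real.log (ε : ℝ)) (𝓝[>] 0) atTop := by
    refine tendsto_neg_atBot_atTop.comp (Real.tendsto_log_nhdsGT_zero.comp ?_)
    refine tendsto_nhdsWithin_iff.2 ⟨?_, ?_⟩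
    · have : Tendsto (fun ε : ℝ≥0 => (ε : ℝ)) (𝓝 0) (𝓝 ((0 : ℝ≥0) : ℝ)) :=
        NNReal.continuous_coe.tendsto 0
      exact this.mono_left nhdsWithin_le_nhds
    · filter_upwards [self_mem_nhdsWithin] with ε hε
      exact NNReal.coe_pos.2 hε
  have hsq : ∀ a : ℝ, Tendsto (fun ε : ℝ≥0 => s + a / (-Real.log (ε : ℝ))) (𝓝[>] 0) (𝓝 s) := by
    intro a
    simpa using (tendsto_const_nhds (x := s)).add (hlog.const_div_atTop a)
  have hev : ∀ᶠ ε : ℝ≥0 in 𝓝[>] 0, 0 < ε ∧ ε < 1 := by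
    filter_upwards [Ioo_mem_nhdsGT (zero_lt_one (α := ℝ≥0))] with ε hε using hε
  refine tendsto_of_tendsto_of_tendsto_of_le_of_le' (hsq (Real.log (1 / C)))
    (hsq (Real.log (2 ^ s / c))) ?_ ?_
  · filter_upwards [hev] with ε hε
    have hε' : (0 : ℝ) < ε := hε.1
    have hl : 0 < -Real.log (ε : ℝ) := neg_pos.2 (Real.log_neg hε' hε.2)
    have h1 := h.le_toNat_covering hK.totallyBounded hε.1 hε.2.le
    have h2 := Real.log_le_log (by positivity) h1
    rw [Real.log_mul (by positivity) (by positivity), Real.log_rpow hε'] at h2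
    rw [le_div_iff₀ hl, add_mul, div_mul_cancel₀ _ hl.ne']
    linarith
  · filter_upwards [hev] with ε hε
    have hε' : (0 : ℝ) < ε := hε.1
    have hl : 0 < -Real.log (ε : ℝ) := neg_pos.2 (Real.log_neg hε' hε.2)
    have h0 : 0 < ((externalCoveringNumber ε K).toNat : ℝ) :=
      lt_of_lt_of_le (by positivity) (h.le_toNat_covering hK.totallyBounded hε.1 hε.2.le)
    have h1 := h.toNat_covering_le hK.totallyBounded hε.1 hε.2.le
    have h2 := Real.log_le_log h0 h1
    rw [Real.log_mul (by positivity) (by positivity), Real.log_rpow hε'] at h2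
    rw [div_le_iff₀ hl, add_mul, div_mul_cancel₀ _ hl.ne']
    linarith

/-! ### Hausdorff dimension -/

theorem measure_le_of_ediam_le (h : IsAhlforsRegular μ K s c C) (A : Set ℂ) (hA : ediam A ≤ 1) :
    μ A ≤ ENNReal.ofReal C * ediam A ^ s := by
  have hC := h.C_pos
  have hs := h.s_pos
  rcases A.eq_empty_or_nonempty with rfl | ⟨z, hz⟩
  · simp
  have hne : ediam A ≠ ⊤ := ne_top_of_le_ne_top ENNReal.one_ne_top hA
  have hsub : ∀ r : ℝ, diam A ≤ r → A ⊆ closedBall z r := fun r hr y hy =>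
    (dist_le_diam_of_mem (isBounded_iff_ediam_ne_top.2 hne) hy hz).trans hr
  have hd1 : diam A ≤ 1 := ENNReal.toReal_le_of_le_ofReal zero_le_one (by simpa using hA)
  have hd0 : 0 ≤ diam A := diam_nonneg
  have hdA : ediam A = ENNReal.ofReal (diam A) := (ENNReal.ofReal_toReal hne).symm
  rw [hdA, ENNReal.ofReal_rpow_of_nonneg hd0 hs.le, ← ENNReal.ofReal_mul hC.le]
  -- The bound on balls needs a positive radius. A set of diameter 0 is null, as the limit of that
  -- bound for r → 0.
  rcases hd0.eq_or_lt with h0 | hpos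
  · rw [← h0, Real.zero_rpow hs.ne', mul_zero, ENNReal.ofReal_zero]
    have hlim : Tendsto (fun r : ℝ => ENNReal.ofReal (C * r ^ s)) (𝓝[>] 0) (𝓝 0) := by
      have h1 : Tendsto (fun r : ℝ => C * r ^ s) (𝓝 0) (𝓝 (C * 0 ^ s)) :=
        ((Real.continuousAt_rpow_const 0 s (Or.inr hs.le)).tendsto).const_mul C
      rw [Real.zero_rpow hs.ne', mul_zero] at h1
      have h2 := (ENNReal.continuous_ofReal.tendsto _).comp h1
      rw [ENNReal.ofReal_zero] at h2
      exact h2.mono_left nhdsWithin_le_nhds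
    refine ge_of_tendsto hlim ?_
    filter_upwards [Ioo_mem_nhdsGT (zero_lt_one (α := ℝ))] with r hr
    exact (measure_mono (hsub r (by linarith [hr.1]))).trans (h.upper z r hr.1 hr.2.le)
  · exact (measure_mono (hsub _ le_rfl)).trans (h.upper z _ hpos hd1)

/-- The mass distribution principle: μ of a small set is at most C times the s-th power of its
diameter, so the s-dimensional Hausdorff measure of K is at least 1 / C. -/
theorem dimH_ge (h : IsAhlforsRegular μ K s c C) : ENNReal.ofReal s ≤ dimH K := by
  have hC := h.C_pos
  have hle : (ENNReal.ofReal C)⁻¹ • μ ≤ Measure.hausdorffMeasure s := by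
    refine Measure.le_hausdorffMeasure s _ 1 zero_lt_one fun A hA => ?_
    rw [Measure.smul_apply, smul_eq_mul, mul_comm, ← div_eq_mul_inv]
    exact ENNReal.div_le_of_le_mul' (h.measure_le_of_ediam_le A hA)
  have h1 := hle K
  rw [Measure.smul_apply, h.measure_eq_one, smul_eq_mul, mul_one] at h1
  have h2 : Measure.hausdorffMeasure s K ≠ 0 := by
    intro h0
    rw [h0] at h1
    simp at h1
  have := le_dimH_of_hausdorffMeasure_ne_zero (d := s.toNNReal)
    (by rwa [Real.coe_toNNReal _ h.s_pos.le] : Measure.hausdorffMeasure (s.toNNReal : ℝ) K ≠ 0)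
  exact this

/-- A maximal separated set of scale ε has at most ε^(-s) / c points, and balls of diameter at most
4 ε about them cover K. This keeps the s-dimensional Hausdorff measure below 4^s / c. -/
theorem dimH_le (h : IsAhlforsRegular μ K s c C) (hK : IsCompact K) : dimH K ≤ ENNReal.ofReal s := by
  have hc := h.c_pos
  have hs := h.s_pos
  have hpos : ∀ n : ℕ, (0 : ℝ) < 1 / ((n : ℝ) + 1) := fun n => by positivity
  choose t htK hsep hcov using fun n : ℕ => exists_separated_cover hK.totallyBounded (hpos n)
  refine dimH_le_of_hausdorffMeasure_ne_top (d := s.toNNReal) ?_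
  rw [Real.coe_toNNReal _ hs.le]
  have hr : Tendsto (fun n : ℕ => ENNReal.ofReal (4 * (1 / ((n : ℝ) + 1)))) atTop (𝓝 0) := by
    have h1 := (tendsto_one_div_add_atTop_nhds_zero_nat (𝕜 := ℝ)).const_mul 4
    rw [mul_zero] at h1
    have h2 := (ENNReal.continuous_ofReal.tendsto _).comp h1
    rwa [ENNReal.ofReal_zero] at h2
  have hdiam : ∀ (n : ℕ) (y : ℂ), ediam (closedBall y (2 * (1 / ((n : ℝ) + 1)))) ≤
      ENNReal.ofReal (4 * (1 / ((n : ℝ) + 1))) := by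
    intro n y
    refine ediam_le fun a ha b hb => ?_
    rw [edist_dist]
    refine ENNReal.ofReal_le_ofReal ?_
    have := dist_triangle_right a b y
    rw [mem_closedBall] at ha hb
    linarith
  have hmain := Measure.hausdorffMeasure_le_liminf_sum (ι := fun n => t n) s K _ hr
    (fun n y => closedBall (y : ℂ) (2 * (1 / ((n : ℝ) + 1))))
    (Eventually.of_forall fun n y => hdiam n y)
    (Eventually.of_forall fun n => by
      have := hcov n
      simpa [Set.iUnion_subtype] using this)
  refine ne_top_of_le_ne_top (b := ENNReal.ofReal (4 ^ s / c)) ENNReal.ofReal_ne_top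
    (hmain.trans ?_)
  refine liminf_le_of_le (by isBoundedDefault) fun b hb => ?_
  obtain ⟨n, hn⟩ := hb.exists
  refine hn.trans ?_
  have hcard := h.card_mul_le_one (hpos n) (by
    rw [div_le_one (by positivity)]
    linarith [(Nat.cast_nonneg n : (0 : ℝ) ≤ n)]) (htK n) (hsep n)
  have hp := hpos n
  calc ∑ y : t n, ediam (closedBall (y : ℂ) (2 * (1 / ((n : ℝ) + 1)))) ^ s
      ≤ ∑ _y : t n, ENNReal.ofReal ((4 * (1 / ((n : ℝ) + 1))) ^ s) := by
        refine Finset.sum_le_sum fun y _ => ?_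
        rw [← ENNReal.ofReal_rpow_of_nonneg (by positivity) hs.le]
        exact ENNReal.rpow_le_rpow (hdiam n y) hs.le
    _ = ENNReal.ofReal ((t n).card * (4 * (1 / ((n : ℝ) + 1))) ^ s) := by
        rw [Finset.sum_const, nsmul_eq_mul, ENNReal.ofReal_mul (Nat.cast_nonneg _),
          ENNReal.ofReal_natCast]
        simp
    _ ≤ ENNReal.ofReal (4 ^ s / c) := by
        refine ENNReal.ofReal_le_ofReal ?_
        rw [Real.mul_rpow (by norm_num) hp.le, le_div_iff₀ hc]
        have h4 : (0 : ℝ) < 4 ^ s := by positivity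
        nlinarith

/-! ### Packing dimension -/

/-- The scale 1/2 makes every diameter 2 r at most 1, so that raising the exponent from s to t only
decreases the sum. -/
theorem packingPremeasureAt_le (h : IsAhlforsRegular μ K s c C) {t : ℝ≥0} (ht : s ≤ t) :
    packingPremeasureAt t (1 / 2) K ≤ ENNReal.ofReal (2 ^ s / c) := by
  have hc := h.c_pos
  refine iSup₂_le fun u hu => ?_
  have h1 := h.sum_le_one (by norm_num) hu
  calc ∑ b ∈ u, ENNReal.ofReal ((2 * b.2) ^ (t : ℝ))
      ≤ ∑ b ∈ u, ENNReal.ofReal (2 ^ s / c) * ENNReal.ofReal (c * b.2 ^ s) := by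
        refine Finset.sum_le_sum fun b hb => ?_
        obtain ⟨-, hb0, hb1⟩ := hu.1 b hb
        rw [← ENNReal.ofReal_mul (by positivity)]
        refine ENNReal.ofReal_le_ofReal ?_
        have h2 : 2 ^ s / c * (c * b.2 ^ s) = (2 * b.2) ^ s := by
          rw [Real.mul_rpow (by norm_num) hb0.le]
          field_simp
        rw [h2]
        exact Real.rpow_le_rpow_of_exponent_ge (by positivity) (by linarith) ht
    _ ≤ ENNReal.ofReal (2 ^ s / c) * 1 := by
        rw [← Finset.mul_sum]
        gcongr
    _ = _ := mul_one _

theorem _root_.KochCurve.packingPremeasure_empty (t : ℝ≥0) : packingPremeasure t ∅ = 0 := by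
  rw [← nonpos_iff_eq_zero]
  have h1 : packingPremeasure t ∅ ≤ packingPremeasureAt t 1 ∅ := iInf₂_le (1 : ℝ) one_pos
  refine h1.trans (iSup₂_le fun u hu => ?_)
  have : u = ∅ := Finset.eq_empty_of_forall_notMem fun b hb => (hu.1 b hb).1
  simp [this]

theorem packingMeasure_ne_top (h : IsAhlforsRegular μ K s c C) {t : ℝ≥0} (ht : s ≤ t) :
    packingMeasure t K ≠ ∞ := by
  refine ne_top_of_le_ne_top (b := ENNReal.ofReal (2 ^ s / c)) ENNReal.ofReal_ne_top ?_
  have hcov : K ⊆ ⋃ i : ℕ, (if i = 0 then K else ∅) := fun z hz =>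
    Set.mem_iUnion.2 ⟨0, by simpa using hz⟩
  have h1 : packingMeasure t K ≤ ∑' i : ℕ, packingPremeasure t (if i = 0 then K else ∅) :=
    iInf₂_le (fun i : ℕ => if i = 0 then K else ∅) hcov
  rw [tsum_eq_single 0 (fun i hi => by rw [if_neg hi, packingPremeasure_empty]), if_pos rfl] at h1
  have h2 : packingPremeasure t K ≤ packingPremeasureAt t (1 / 2) K :=
    iInf₂_le (1 / 2 : ℝ) (by norm_num)
  exact h1.trans (h2.trans (h.packingPremeasureAt_le ht))

/-- Covering the part of A in K by balls of radius 2 ρ takes at least a / (C (2 ρ)^s) of them, where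
a is the mass of A. Their centres can be chosen so that the balls of radius ρ form a packing, whose
sum is at least a constant times (2 ρ)^(t - s), which is unbounded as ρ → 0. -/
theorem packingPremeasure_eq_top (h : IsAhlforsRegular μ K s c C) (hK : IsCompact K) {t : ℝ≥0}
    (ht : t < s) {A : Set ℂ} (hA : μ A ≠ 0) : packingPremeasure t A = ∞ := by
  have hC := h.C_pos
  have hAK : μ (A ∩ K) = μ A := measure_inter_conull h.compl_null
  have hfin : μ (A ∩ K) ≠ ∞ := ne_top_of_le_ne_top (b := 1) ENNReal.one_ne_top
    (h.measure_univ ▸ measure_mono (Set.subset_univ _))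
  set a := (μ (A ∩ K)).toReal with ha
  have ha0 : 0 < a := ENNReal.toReal_pos (hAK ▸ hA) hfin
  have hkey : ∀ ρ : ℝ, 0 < ρ → ρ ≤ 1 / 2 → ∀ ε, ρ ≤ ε →
      ENNReal.ofReal (a / C * (2 * ρ) ^ ((t : ℝ) - s)) ≤ packingPremeasureAt t ε A := by
    intro ρ hρ hρ1 ε hρε
    obtain ⟨u, huA, hsep, hcov⟩ :=
      exists_separated_cover (hK.totallyBounded.subset (Set.inter_subset_right (s := A))) hρ
    have h1 := h.le_card_mul (by positivity : 0 < 2 * ρ) (by linarith) hcov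
    have h2 : a ≤ u.card * (C * (2 * ρ) ^ s) := ENNReal.toReal_le_of_le_ofReal (by positivity) h1
    have hpack := isBallPacking_of_separated hρ huA hsep
    have hpack' : IsBallPacking A ε (u.map (withRadius ρ)) :=
      ⟨fun b hb => ⟨(hpack.1 b hb).1.1, (hpack.1 b hb).2.1, (hpack.1 b hb).2.2.trans hρε⟩, hpack.2⟩
    refine le_trans ?_ (le_iSup₂_of_le _ hpack' le_rfl)
    rw [Finset.sum_map]
    simp only [withRadius_apply, Finset.sum_const, nsmul_eq_mul]
    rw [← ENNReal.ofReal_natCast, ← ENNReal.ofReal_mul (by positivity)]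
    refine ENNReal.ofReal_le_ofReal ?_
    rw [Real.rpow_sub (by positivity), div_mul_div_comm, div_le_iff₀ (by positivity)]
    have hp : 0 < (2 * ρ) ^ (t : ℝ) := by positivity
    nlinarith
  have hlim : Tendsto (fun ρ : ℝ => ENNReal.ofReal (a / C * (2 * ρ) ^ ((t : ℝ) - s)))
      (𝓝[>] 0) (𝓝 ∞) := by
    refine ENNReal.tendsto_ofReal_atTop.comp ?_
    refine Tendsto.const_mul_atTop (by positivity) ?_
    refine (tendsto_rpow_neg_nhdsGT_zero (by linarith)).comp ?_
    refine tendsto_nhdsWithin_iff.2 ⟨?_, ?_⟩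
    · have : Tendsto (fun ρ : ℝ => 2 * ρ) (𝓝 0) (𝓝 (2 * 0)) := (continuous_const_mul 2).tendsto 0
      rw [mul_zero] at this
      exact this.mono_left nhdsWithin_le_nhds
    · filter_upwards [self_mem_nhdsWithin] with ρ hρ
      exact Set.mem_Ioi.2 (mul_pos two_pos (Set.mem_Ioi.1 hρ))
  refine eq_top_iff.2 (le_iInf₂ fun ε hε => ?_)
  refine le_of_tendsto hlim ?_
  filter_upwards [Ioo_mem_nhdsGT (lt_min hε (by norm_num : (0 : ℝ) < 1 / 2))] with ρ hρ
  exact hkey ρ hρ.1 (hρ.2.le.trans (min_le_right _ _)) ε (hρ.2.le.trans (min_le_left _ _))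

/-- In a countable cover of K some member has positive outer mass, and already its premeasure is
infinite. -/
theorem packingMeasure_eq_top (h : IsAhlforsRegular μ K s c C) (hK : IsCompact K) {t : ℝ≥0}
    (ht : t < s) : packingMeasure t K = ∞ := by
  refine eq_top_iff.2 (le_iInf₂ fun A hA => ?_)
  obtain ⟨i, hi⟩ : ∃ i, μ (A i) ≠ 0 := by
    by_contra! hcon
    have h1 : μ K ≤ 0 := (measure_mono hA).trans_eq (measure_iUnion_null hcon)
    rw [h.measure_eq_one] at h1
    simp at h1
  exact (h.packingPremeasure_eq_top hK ht hi).ge.trans (ENNReal.le_tsum i)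

theorem packingDim_eq (h : IsAhlforsRegular μ K s c C) (hK : IsCompact K) :
    packingDim K = ENNReal.ofReal s := by
  refine le_antisymm (iSup₂_le fun t ht => ?_) ?_
  · by_contra! hlt
    refine h.packingMeasure_ne_top ?_ ht
    rw [← ENNReal.ofReal_coe_nnreal] at hlt
    exact ((ENNReal.ofReal_lt_ofReal_iff_of_nonneg h.s_pos.le).1 hlt).le
  · refine le_of_forall_lt fun b hb => ?_
    obtain ⟨t, hbt, hts⟩ := ENNReal.lt_iff_exists_nnreal_btwn.1 hb
    refine hbt.trans_le (le_iSup₂_of_le t (h.packingMeasure_eq_top hK ?_) le_rfl)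
    rw [← ENNReal.ofReal_coe_nnreal] at hts
    exact (ENNReal.ofReal_lt_ofReal_iff_of_nonneg t.2).1 hts

end IsAhlforsRegular

/-! ### Self-similarity of the points `p k` -/

section Points

variable {m : ℕ} {d : Fin (m + 1) → ℤˣ} {δ : ℕ → ℤˣ}

theorem IsThueMorse.apply_of_lt (hδ : IsThueMorse d δ) {k : ℕ} (hk : k < m + 1) :
    δ k = d ⟨k, hk⟩ := by
  have h := (isThueMorse_iff d δ).1 hδ
  simpa [h.1] using h.2 0 ⟨k, hk⟩

theorem IsThueMorse.apply_mul_add (hδ : IsThueMorse d δ) (r : ℕ) {k : ℕ} (hk : k < m + 1) :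
    δ ((m + 1) * r + k) = δ r * δ k := by
  rw [hδ.apply_of_lt hk]
  exact ((isThueMorse_iff d δ).1 hδ).2 r ⟨k, hk⟩

/-- The exponentials agree because (m + 1) r + k and r + k differ by m r, a multiple of the period
m. -/
theorem step_mul_add (hm : m ≠ 0) (hδ : IsThueMorse d δ) (r : ℕ) {k : ℕ} (hk : k < m + 1) :
    step m δ ((m + 1) * r + k) = step m δ r * step m δ k := by
  have hm' : (m : ℂ) ≠ 0 := Nat.cast_ne_zero.2 hm
  have hexp : Complex.exp (2 * (((m + 1) * r + k : ℕ) : ℂ) * (Real.pi : ℂ) * Complex.I / (m : ℂ)) =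
      Complex.exp (2 * (r : ℂ) * (Real.pi : ℂ) * Complex.I / (m : ℂ)) *
        Complex.exp (2 * (k : ℂ) * (Real.pi : ℂ) * Complex.I / (m : ℂ)) := by
    rw [← Complex.exp_add]
    refine Complex.exp_eq_exp_iff_exists_int.2 ⟨r, ?_⟩
    push_cast
    field_simp
    ring
  rw [step, step, step, hexp, hδ.apply_mul_add r hk]
  push_cast
  ring

theorem norm_step (m : ℕ) (δ : ℕ → ℤˣ) (k : ℕ) : ‖step m δ k‖ = 1 := by
  have h1 : 2 * (k : ℂ) * (Real.pi : ℂ) * Complex.I / (m : ℂ) =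
      ((2 * k * Real.pi / m : ℝ) : ℂ) * Complex.I := by
    push_cast
    ring
  rw [step, h1, norm_mul, Complex.norm_exp_ofReal_mul_I, mul_one]
  rcases Int.units_eq_one_or (δ k) with h | h <;> simp [h]

theorem p_zero (m : ℕ) (δ : ℕ → ℤˣ) : p m δ 0 = 0 := by simp [p]

theorem p_succ (m : ℕ) (δ : ℕ → ℤˣ) (k : ℕ) : p m δ (k + 1) = p m δ k + step m δ k := by
  rw [p, p, Finset.sum_range_succ]

theorem norm_p_le (m : ℕ) (δ : ℕ → ℤˣ) (k : ℕ) : ‖p m δ k‖ ≤ k := by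
  refine (norm_sum_le _ _).trans ?_
  simp [norm_step]

theorem p_mul_add_aux (hm : m ≠ 0) (hδ : IsThueMorse d δ) (r : ℕ) {k : ℕ} (hk : k ≤ m + 1) :
    p m δ ((m + 1) * r + k) = p m δ ((m + 1) * r) + step m δ r * p m δ k := by
  induction k with
  | zero => simp [p_zero]
  | succ k ih =>
    rw [← add_assoc, p_succ, ih (by omega), step_mul_add hm hδ r (by omega), p_succ]
    ring

theorem p_mul (hm : m ≠ 0) (hδ : IsThueMorse d δ) (r : ℕ) :
    p m δ ((m + 1) * r) = p m δ (m + 1) * p m δ r := by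
  induction r with
  | zero => simp [p_zero]
  | succ r ih =>
    rw [Nat.mul_succ, p_mul_add_aux hm hδ r le_rfl, ih, p_succ m δ r]
    ring

theorem p_mul_add (hm : m ≠ 0) (hδ : IsThueMorse d δ) (r : ℕ) {k : ℕ} (hk : k ≤ m + 1) :
    p m δ ((m + 1) * r + k) = p m δ (m + 1) * p m δ r + step m δ r * p m δ k := by
  rw [p_mul_add_aux hm hδ r hk, p_mul hm hδ]

/-- The similarity that maps the curve onto its `k`-th part of level `n`. -/
noncomputable def levelMap (m : ℕ) (δ : ℕ → ℤˣ) (n k : ℕ) (z : ℂ) : ℂ :=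
  (p m δ k + step m δ k * z) / p m δ (m + 1) ^ n

/-- The n-fold compositions of the maps S_j are thus numbered by k < (m + 1)^n, the base m + 1
digits of k being the word of indices. -/
theorem levelMap_succ (hm : m ≠ 0) (hδ : IsThueMorse d δ) (hx : p m δ (m + 1) ≠ 0) (n r : ℕ)
    (j : Fin (m + 1)) (z : ℂ) :
    levelMap m δ (n + 1) ((m + 1) * r + j) z = levelMap m δ n r (ifs m δ j z) := by
  rw [levelMap, levelMap, ifs, p_mul_add hm hδ r j.2.le, step_mul_add hm hδ r j.2]
  field_simp
  ring

theorem step_ne_zero (m : ℕ) (δ : ℕ → ℤˣ) (k : ℕ) : step m δ k ≠ 0 := by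
  rw [← norm_ne_zero_iff, norm_step]
  exact one_ne_zero

theorem levelMap_injective (hx : p m δ (m + 1) ≠ 0) (n k : ℕ) :
    Function.Injective (levelMap m δ n k) := by
  intro z w h
  have hs := step_ne_zero m δ k
  rw [levelMap, levelMap, div_left_inj' (pow_ne_zero n hx)] at h
  exact mul_left_cancel₀ hs (add_left_cancel h)

theorem dist_levelMap (n k : ℕ) (z w : ℂ) :
    dist (levelMap m δ n k z) (levelMap m δ n k w) = dist z w / ‖p m δ (m + 1)‖ ^ n := by
  rw [dist_eq_norm, dist_eq_norm, levelMap, levelMap, ← sub_div, norm_div, norm_pow]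
  congr 1
  rw [add_sub_add_left_eq_sub, ← mul_sub, norm_mul, norm_step, one_mul]

theorem ball_subset_levelMap_image (hx : p m δ (m + 1) ≠ 0) (n k : ℕ) (v : ℂ) (ρ : ℝ) :
    ball (levelMap m δ n k v) (ρ / ‖p m δ (m + 1)‖ ^ n) ⊆ levelMap m δ n k '' ball v ρ := by
  intro y hy
  have hs := step_ne_zero m δ k
  have hxn := pow_ne_zero n hx
  have hy' : levelMap m δ n k ((y * p m δ (m + 1) ^ n - p m δ k) / step m δ k) = y := by
    rw [levelMap]
    field_simp
    ring
  refine ⟨_, ?_, hy'⟩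
  rw [mem_ball, ← hy', dist_levelMap] at hy
  exact (div_lt_div_iff_of_pos_right (pow_pos (norm_pos_iff.2 hx) n)).1 hy

theorem levelMap_image_subset (hm : m ≠ 0) (hδ : IsThueMorse d δ) (hx : p m δ (m + 1) ≠ 0)
    {V : Set ℂ} (hV : (⋃ j, ifs m δ j '' V) ⊆ V) (n r : ℕ) (j : Fin (m + 1)) :
    levelMap m δ (n + 1) ((m + 1) * r + j) '' V ⊆ levelMap m δ n r '' V := by
  rintro _ ⟨z, hz, rfl⟩
  rw [levelMap_succ hm hδ hx]
  exact ⟨_, hV (Set.mem_iUnion.2 ⟨j, z, hz, rfl⟩), rfl⟩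

/-- Two copies with different parents lie in the disjoint images of these parents. Two with the same
parent are images of disjoint sets under one injective map. -/
theorem levelMap_disjoint (hm : m ≠ 0) (hδ : IsThueMorse d δ) (hx : p m δ (m + 1) ≠ 0)
    {V : Set ℂ} (hV : (⋃ j, ifs m δ j '' V) ⊆ V)
    (hdisj : Pairwise fun i j => Disjoint (ifs m δ i '' V) (ifs m δ j '' V)) (n : ℕ) :
    ∀ k < (m + 1) ^ n, ∀ l < (m + 1) ^ n, k ≠ l →
      Disjoint (levelMap m δ n k '' V) (levelMap m δ n l '' V) := by
  induction n with
  | zero =>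
    intro k hk l hl hkl
    simp at hk hl
    omega
  | succ n ih =>
    intro k hk l hl hkl
    have hN : 0 < m + 1 := m.succ_pos
    obtain ⟨hk1, hl1⟩ : k / (m + 1) < (m + 1) ^ n ∧ l / (m + 1) < (m + 1) ^ n := by
      rw [Nat.div_lt_iff_lt_mul hN, Nat.div_lt_iff_lt_mul hN, ← pow_succ]
      exact ⟨hk, hl⟩
    have hk2 : k = (m + 1) * (k / (m + 1)) + (⟨k % (m + 1), Nat.mod_lt _ hN⟩ : Fin (m + 1)) :=
      (Nat.div_add_mod k (m + 1)).symm
    have hl2 : l = (m + 1) * (l / (m + 1)) + (⟨l % (m + 1), Nat.mod_lt _ hN⟩ : Fin (m + 1)) :=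
      (Nat.div_add_mod l (m + 1)).symm
    by_cases hr : k / (m + 1) = l / (m + 1)
    · have hj : (⟨k % (m + 1), Nat.mod_lt _ hN⟩ : Fin (m + 1)) ≠
          ⟨l % (m + 1), Nat.mod_lt _ hN⟩ := by
        intro h
        apply hkl
        rw [hk2, hl2, hr, h]
      have himg : ∀ (r : ℕ) (j : Fin (m + 1)), levelMap m δ (n + 1) ((m + 1) * r + j) '' V =
          levelMap m δ n r '' (ifs m δ j '' V) := by
        intro r j
        rw [Set.image_image]
        exact Set.image_congr fun z _ => levelMap_succ hm hδ hx n r j z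
      rw [hk2, hl2, himg, himg, ← hr]
      exact (hdisj hj).image (levelMap_injective hx n _).injOn (Set.subset_univ _)
        (Set.subset_univ _)
    · have h1 := ih _ hk1 _ hl1 hr
      rw [hk2, hl2]
      exact h1.mono (levelMap_image_subset hm hδ hx hV n _ _)
        (levelMap_image_subset hm hδ hx hV n _ _)

end Points

/-! ### The vertices of the rescaled polygonal lines -/

/-- The point `p(m+1)^{-n} p(k)`. -/
noncomputable def vertex (m : ℕ) (δ : ℕ → ℤˣ) (n k : ℕ) : ℂ := p m δ k / p m δ (m + 1) ^ n

section Vertices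

variable {m : ℕ} {d : Fin (m + 1) → ℤˣ} {δ : ℕ → ℤˣ} {x : ℝ}

/-- A vertex is reached from the one it refines by at most m steps of length x^(-(n+1)). -/
theorem dist_vertex_succ (hm : m ≠ 0) (hδ : IsThueMorse d δ) (hx : p m δ (m + 1) = x)
    (hx3 : 3 ≤ x) (n k : ℕ) :
    dist (vertex m δ (n + 1) k) (vertex m δ n (k / (m + 1))) ≤ m / x ^ (n + 1) := by
  have hN : 0 < m + 1 := m.succ_pos
  have hx0 : 0 < x := by linarith
  have hxc : (x : ℂ) ≠ 0 := Complex.ofReal_ne_zero.2 hx0.ne'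
  have hmod : k % (m + 1) < m + 1 := Nat.mod_lt _ hN
  have h1 : vertex m δ (n + 1) k - vertex m δ n (k / (m + 1)) =
      step m δ (k / (m + 1)) * p m δ (k % (m + 1)) / (x : ℂ) ^ (n + 1) := by
    conv_lhs => rw [← Nat.div_add_mod k (m + 1)]
    rw [vertex, vertex, p_mul_add hm hδ _ hmod.le, hx, Nat.mul_add_div hN, Nat.div_eq_of_lt hmod,
      add_zero]
    field_simp
    ring
  rw [dist_eq_norm, h1, norm_div, norm_mul, norm_step, one_mul, norm_pow, Complex.norm_real,
    Real.norm_of_nonneg hx0.le]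
  gcongr
  exact (norm_p_le m δ _).trans (by exact_mod_cast Nat.lt_succ_iff.1 hmod)

/-- The displacements form a geometric series of ratio 1 / x. The induction only needs 2 / x ≤ 1. -/
theorem dist_vertex_add (hm : m ≠ 0) (hδ : IsThueMorse d δ) (hx : p m δ (m + 1) = x)
    (hx3 : 3 ≤ x) (i n k : ℕ) :
    dist (vertex m δ (n + i) k) (vertex m δ n (k / (m + 1) ^ i)) ≤ m / x ^ n := by
  have hx0 : 0 < x := by linarith
  induction i generalizing n with
  | zero =>
    simp only [add_zero, pow_zero, Nat.div_one, dist_self]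
    positivity
  | succ i ih =>
    have h1 := ih (n + 1)
    have h2 := dist_vertex_succ hm hδ hx hx3 n (k / (m + 1) ^ i)
    rw [Nat.div_div_eq_div_mul, ← pow_succ] at h2
    rw [show n + 1 + i = n + (i + 1) by ring] at h1
    have h3 : (m : ℝ) / x ^ (n + 1) + m / x ^ (n + 1) ≤ m / x ^ n := by
      rw [pow_succ, ← add_div, div_le_div_iff₀ (by positivity) (by positivity)]
      have hp : 0 ≤ (m : ℝ) * x ^ n := by positivity
      nlinarith
    exact (dist_triangle _ _ _).trans ((add_le_add h1 h2).trans h3)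

/-! ### The limit set -/

/-- The points that are approximated at every level by a vertex of the polygonal line. -/
def limitSet (m : ℕ) (δ : ℕ → ℤˣ) (x : ℝ) : Set ℂ :=
  {z | ∀ n : ℕ, ∃ k < (m + 1) ^ n, dist z (vertex m δ n k) ≤ m / x ^ n}

theorem isCompact_limitSet : IsCompact (limitSet m δ x) := by
  refine isCompact_of_isClosed_isBounded ?_ ?_
  · have h : limitSet m δ x =
        ⋂ n : ℕ, ⋃ k ∈ Set.Iio ((m + 1) ^ n), closedBall (vertex m δ n k) (m / x ^ n) := by
      ext z
      simp [limitSet]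
    rw [h]
    exact isClosed_iInter fun n => (Set.finite_Iio _).isClosed_biUnion fun k _ => isClosed_closedBall
  · refine (isBounded_closedBall (x := (0 : ℂ)) (r := m)).subset fun z hz => ?_
    obtain ⟨k, hk, h⟩ := hz 0
    obtain rfl : k = 0 := by simpa using hk
    simpa [vertex, p_zero] using h

/-- The number of the `n`-th level interval that contains `t`. -/
noncomputable def address (m n : ℕ) (t : ℝ) : ℕ := ⌊t * ((m : ℝ) + 1) ^ n⌋₊

/-- Addresses of different levels are truncations of each other, which makes the vertices addressed
by t a Cauchy sequence. -/
theorem address_div (n i : ℕ) (t : ℝ) :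
    address m (n + i) t / (m + 1) ^ i = address m n t := by
  have h0 : ((m : ℝ) + 1) ^ i ≠ 0 := by positivity
  rw [address, address, ← Nat.floor_div_natCast]
  congr 1
  push_cast
  field_simp
  ring

theorem address_lt {t : ℝ} (ht : t < 1) (n : ℕ) : address m n t < (m + 1) ^ n := by
  rw [address, Nat.floor_lt' (by positivity)]
  push_cast
  have : (0 : ℝ) < ((m : ℝ) + 1) ^ n := by positivity
  nlinarith

theorem address_natCast_div (n k : ℕ) : address m n ((k : ℝ) / ((m : ℝ) + 1) ^ n) = k := by
  rw [address, div_mul_cancel₀ _ (by positivity), Nat.floor_natCast]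

theorem exists_tendsto_vertex (hm : m ≠ 0) (hδ : IsThueMorse d δ) (hx : p m δ (m + 1) = x)
    (hx3 : 3 ≤ x) (t : ℝ) :
    ∃ z, Tendsto (fun n => vertex m δ n (address m n t)) atTop (𝓝 z) := by
  refine cauchySeq_tendsto_of_complete (cauchySeq_of_le_tendsto_0' (fun n => (m : ℝ) / x ^ n) ?_ ?_)
  · intro n l hnl
    obtain ⟨i, rfl⟩ := Nat.exists_eq_add_of_le hnl
    rw [dist_comm, ← address_div n i t]
    exact dist_vertex_add hm hδ hx hx3 i n _
  · exact (tendsto_pow_atTop_atTop_of_one_lt (by linarith)).const_div_atTop _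

/-- The limit of the vertices with address `t`. -/
noncomputable def curve (m : ℕ) (δ : ℕ → ℤˣ) (t : ℝ) : ℂ :=
  limUnder atTop fun n => vertex m δ n (address m n t)

theorem tendsto_curve (hm : m ≠ 0) (hδ : IsThueMorse d δ) (hx : p m δ (m + 1) = x)
    (hx3 : 3 ≤ x) (t : ℝ) :
    Tendsto (fun n => vertex m δ n (address m n t)) atTop (𝓝 (curve m δ t)) :=
  tendsto_nhds_limUnder (exists_tendsto_vertex hm hδ hx hx3 t)

theorem dist_curve_vertex (hm : m ≠ 0) (hδ : IsThueMorse d δ) (hx : p m δ (m + 1) = x)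
    (hx3 : 3 ≤ x) (n : ℕ) (t : ℝ) :
    dist (curve m δ t) (vertex m δ n (address m n t)) ≤ m / x ^ n := by
  refine le_of_tendsto ((tendsto_curve hm hδ hx hx3 t).dist tendsto_const_nhds) ?_
  filter_upwards [eventually_ge_atTop n] with l hl
  obtain ⟨i, rfl⟩ := Nat.exists_eq_add_of_le hl
  rw [← address_div n i t]
  exact dist_vertex_add hm hδ hx hx3 i n _

theorem curve_mem_limitSet (hm : m ≠ 0) (hδ : IsThueMorse d δ) (hx : p m δ (m + 1) = x)
    (hx3 : 3 ≤ x) {t : ℝ} (ht : t < 1) : curve m δ t ∈ limitSet m δ x :=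
  fun n => ⟨_, address_lt ht n, dist_curve_vertex hm hδ hx hx3 n t⟩

theorem measurable_curve (hm : m ≠ 0) (hδ : IsThueMorse d δ) (hx : p m δ (m + 1) = x)
    (hx3 : 3 ≤ x) : Measurable (curve m δ) := by
  refine measurable_of_tendsto_metrizable (f := fun n t => vertex m δ n (address m n t)) ?_
    (tendsto_pi_nhds.2 fun t => tendsto_curve hm hδ hx hx3 t)
  intro n
  have h1 : Measurable (address m n) := Nat.measurable_floor.comp (measurable_id.mul_const _)
  exact (measurable_from_top (f := vertex m δ n)).comp h1

/-- At level n the Hausdorff distance is at most (m + 1) / x^n: one rescaled edge from a point of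
the polygonal line to a vertex, and m / x^n from the vertex to the curve. -/
theorem isKochCurve_limitSet (hm : m ≠ 0) (hδ : IsThueMorse d δ) (hx : p m δ (m + 1) = x)
    (hx3 : 3 ≤ x) : IsKochCurve m δ (limitSet m δ x) := by
  have hx0 : 0 < x := by linarith
  refine ⟨⟨_, curve_mem_limitSet hm hδ hx hx3 zero_lt_one⟩, isCompact_limitSet, ?_⟩
  have hlim : Tendsto (fun n : ℕ => ENNReal.ofReal (((m : ℝ) + 1) / x ^ n)) atTop (𝓝 0) := by
    have h1 : Tendsto (fun n : ℕ => ((m : ℝ) + 1) / x ^ n) atTop (𝓝 0) :=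
      (tendsto_pow_atTop_atTop_of_one_lt (by linarith)).const_div_atTop _
    have h2 := (ENNReal.continuous_ofReal.tendsto _).comp h1
    rwa [ENNReal.ofReal_zero] at h2
  refine tendsto_of_tendsto_of_tendsto_of_le_of_le tendsto_const_nhds hlim (fun _ => zero_le)
    fun n => ?_
  refine hausdorffEDist_le_of_mem_edist ?_ ?_
  · rintro _ ⟨y, hy, rfl⟩
    obtain ⟨k, hk, hy⟩ := Set.mem_iUnion₂.1 hy
    rw [Finset.mem_Icc] at hk
    obtain ⟨l, rfl⟩ : ∃ l, k = l + 1 := ⟨k - 1, by omega⟩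
    rw [Nat.add_sub_cancel] at hy
    have ht : (l : ℝ) / ((m : ℝ) + 1) ^ n < 1 := by
      rw [div_lt_one (by positivity)]
      exact_mod_cast hk.2
    refine ⟨curve m δ ((l : ℝ) / ((m : ℝ) + 1) ^ n), curve_mem_limitSet hm hδ hx hx3 ht, ?_⟩
    rw [edist_dist]
    refine ENNReal.ofReal_le_ofReal ?_
    have h1 := dist_curve_vertex hm hδ hx hx3 n ((l : ℝ) / ((m : ℝ) + 1) ^ n)
    rw [address_natCast_div] at h1
    have h2 : dist y (p m δ l) ≤ 1 := by
      rw [segment_eq_image'] at hy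
      obtain ⟨θ, ⟨h0, h1⟩, rfl⟩ := hy
      rw [p_succ, dist_eq_norm]
      simp only [add_sub_cancel_left, norm_smul, norm_step, mul_one, Real.norm_of_nonneg h0]
      exact h1
    have h3 : dist ((p m δ (m + 1) ^ n)⁻¹ * y) (vertex m δ n l) ≤ 1 / x ^ n := by
      rw [vertex, div_eq_inv_mul, dist_eq_norm, ← mul_sub, norm_mul, norm_inv, norm_pow, hx,
        Complex.norm_real, Real.norm_of_nonneg hx0.le, ← dist_eq_norm, one_div]
      exact mul_le_of_le_one_right (by positivity) h2
    calc _ ≤ dist ((p m δ (m + 1) ^ n)⁻¹ * y) (vertex m δ n l) +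
          dist (curve m δ ((l : ℝ) / ((m : ℝ) + 1) ^ n)) (vertex m δ n l) :=
            dist_triangle_right _ _ _
      _ ≤ 1 / x ^ n + m / x ^ n := add_le_add h3 h1
      _ = _ := by ring
  · intro z hz
    obtain ⟨k, hk, h⟩ := hz n
    refine ⟨vertex m δ n k, ⟨p m δ k, ?_, by rw [vertex, div_eq_inv_mul]⟩, ?_⟩
    · refine Set.mem_iUnion₂.2 ⟨k + 1, Finset.mem_Icc.2 ⟨by omega, hk⟩, ?_⟩
      rw [Nat.add_sub_cancel]
      exact left_mem_segment ℝ _ _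
    · rw [edist_dist]
      refine ENNReal.ofReal_le_ofReal (h.trans ?_)
      gcongr
      linarith

theorem IsKochCurve.eq {K K' : Set ℂ} (h : IsKochCurve m δ K) (h' : IsKochCurve m δ K') :
    K' = K := by
  refine (h'.2.1.isClosed.hausdorffEDist_zero_iff h.2.1.isClosed).1 ?_
  have hsum := h'.2.2.add h.2.2
  rw [add_zero] at hsum
  refine le_antisymm (ge_of_tendsto hsum (Eventually.of_forall fun n => ?_)) zero_le
  rw [hausdorffEDist_comm (t := K')]
  exact hausdorffEDist_triangle

end Vertices

/-! ### The natural measure on the limit set -/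

/-- The image of Lebesgue measure on `[0, 1)` under the parametrization of the limit set. -/
noncomputable def naturalMeasure (m : ℕ) (δ : ℕ → ℤˣ) : Measure ℂ :=
  (volume.restrict (Set.Ico (0 : ℝ) 1)).map (curve m δ)

section NaturalMeasure

variable {m : ℕ} {d : Fin (m + 1) → ℤˣ} {δ : ℕ → ℤˣ} {x : ℝ}

theorem naturalMeasure_apply (hm : m ≠ 0) (hδ : IsThueMorse d δ) (hx : p m δ (m + 1) = x)
    (hx3 : 3 ≤ x) {A : Set ℂ} (hA : MeasurableSet A) :
    naturalMeasure m δ A = volume (curve m δ ⁻¹' A ∩ Set.Ico 0 1) := by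
  rw [naturalMeasure, Measure.map_apply (measurable_curve hm hδ hx hx3) hA,
    Measure.restrict_apply (measurable_curve hm hδ hx hx3 hA)]

/-- The interval of the parameters whose `n`-th address is `k`. -/
def addressInterval (m n k : ℕ) : Set ℝ :=
  Set.Ico ((k : ℝ) / ((m : ℝ) + 1) ^ n) (((k : ℝ) + 1) / ((m : ℝ) + 1) ^ n)

theorem mem_addressInterval {n k : ℕ} {t : ℝ} (ht : 0 ≤ t) :
    t ∈ addressInterval m n k ↔ address m n t = k := by
  have hN : (0 : ℝ) < ((m : ℝ) + 1) ^ n := by positivity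
  rw [addressInterval, Set.mem_Ico, address, Nat.floor_eq_iff (by positivity), div_le_iff₀ hN,
    lt_div_iff₀ hN]

theorem volume_addressInterval (n k : ℕ) :
    volume (addressInterval m n k) = ENNReal.ofReal (1 / ((m : ℝ) + 1) ^ n) := by
  rw [addressInterval, Real.volume_Ico, ← sub_div, add_sub_cancel_left]

theorem addressInterval_subset {n k : ℕ} (hk : k < (m + 1) ^ n) :
    addressInterval m n k ⊆ Set.Ico 0 1 := by
  intro t ht
  refine ⟨le_trans (by positivity) ht.1, ht.2.trans_le ?_⟩
  rw [div_le_one (by positivity)]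
  exact_mod_cast hk

/-- Only boundedly many vertices of level `n` lie within a distance comparable to `x⁻ⁿ` of a point,
if the open set condition holds. -/
theorem exists_card_vertex_le (hm : m ≠ 0) (hδ : IsThueMorse d δ) (hx : p m δ (m + 1) = x)
    (hx3 : 3 ≤ x) (hosc : OpenSetCondition (ifs m δ)) :
    ∃ M : ℝ, 0 < M ∧ ∀ (n : ℕ) (z : ℂ),
      (((Finset.range ((m + 1) ^ n)).filter
        fun k => dist z (vertex m δ n k) ≤ ((m : ℝ) + 1) / x ^ n).card : ℝ) ≤ M := by
  obtain ⟨V, ⟨v, hv⟩, hVb, hVo, hV, hdisj⟩ := hosc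
  have hx0 : 0 < x := by linarith
  have hxc : p m δ (m + 1) ≠ 0 := by
    rw [hx]
    exact Complex.ofReal_ne_zero.2 hx0.ne'
  have hnorm : ‖p m δ (m + 1)‖ = x := by
    rw [hx, Complex.norm_real, Real.norm_of_nonneg hx0.le]
  obtain ⟨ρ, hρ, hball⟩ := Metric.isOpen_iff.1 hVo v hv
  -- The ratio of two areas: disjoint balls of radius ρ / x^n about the images of v, one for each
  -- vertex counted, all lie in the ball about z of radius (m + 1 + ‖v‖ + ρ) / x^n.
  refine ⟨(((m : ℝ) + 1 + ‖v‖ + ρ) / ρ) ^ 2, by positivity, fun n z => ?_⟩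
  set I := (Finset.range ((m + 1) ^ n)).filter
        fun k => dist z (vertex m δ n k) ≤ ((m : ℝ) + 1) / x ^ n with hI
  have hxn : 0 < x ^ n := by positivity
  have hsub : ∀ k ∈ I, ball (levelMap m δ n k v) (ρ / x ^ n) ⊆
      ball z (((m : ℝ) + 1 + ‖v‖ + ρ) / x ^ n) := by
    intro k hk
    refine ball_subset_ball' ?_
    have h1 : dist (levelMap m δ n k v) (vertex m δ n k) = ‖v‖ / x ^ n := by
      rw [levelMap, vertex, dist_eq_norm, ← sub_div, add_sub_cancel_left, norm_div, norm_mul,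
        norm_step, one_mul, norm_pow, hnorm]
    have h2 := (Finset.mem_filter.1 hk).2
    have h3 := dist_triangle_right (levelMap m δ n k v) z (vertex m δ n k)
    rw [h1] at h3
    calc ρ / x ^ n + dist (levelMap m δ n k v) z
        ≤ ρ / x ^ n + (‖v‖ / x ^ n + ((m : ℝ) + 1) / x ^ n) := by linarith
      _ = _ := by ring
  have hdis : (I : Set ℕ).PairwiseDisjoint fun k => ball (levelMap m δ n k v) (ρ / x ^ n) := by
    intro k hk l hl hkl
    have hk' := Finset.mem_range.1 (Finset.mem_filter.1 hk).1
    have hl' := Finset.mem_range.1 (Finset.mem_filter.1 hl).1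
    have h1 := levelMap_disjoint hm hδ hxc hV hdisj n k hk' l hl' hkl
    refine h1.mono ?_ ?_
    · have := ball_subset_levelMap_image hxc n k v ρ
      rw [hnorm] at this
      exact this.trans (Set.image_mono hball)
    · have := ball_subset_levelMap_image hxc n l v ρ
      rw [hnorm] at this
      exact this.trans (Set.image_mono hball)
  have hvol : ∑ k ∈ I, volume (ball (levelMap m δ n k v) (ρ / x ^ n)) ≤
      volume (ball z (((m : ℝ) + 1 + ‖v‖ + ρ) / x ^ n)) := by
    rw [← measure_biUnion_finset hdis fun k _ => measurableSet_ball]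
    exact measure_mono (Set.iUnion₂_subset hsub)
  simp only [Complex.volume_ball, Finset.sum_const, nsmul_eq_mul] at hvol
  have hπ0 : ((NNReal.pi : ℝ≥0) : ℝ≥0∞) ≠ 0 :=
    ENNReal.coe_ne_zero.2 NNReal.pi_ne_zero
  rw [← mul_assoc, ENNReal.mul_le_mul_iff_left hπ0 ENNReal.coe_ne_top,
    ← ENNReal.ofReal_pow (by positivity), ← ENNReal.ofReal_pow (by positivity),
    ← ENNReal.ofReal_natCast, ← ENNReal.ofReal_mul (Nat.cast_nonneg _),
    ENNReal.ofReal_le_ofReal_iff (by positivity)] at hvol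
  rw [div_pow, le_div_iff₀ (by positivity)]
  rw [div_pow, div_pow, mul_div_assoc', div_le_div_iff_of_pos_right (by positivity)] at hvol
  exact hvol

/-- A parameter whose point falls into the ball has its level n vertex within (m + 1) / x^n of z, so
its address is one of those counted. -/
theorem naturalMeasure_closedBall_le (hm : m ≠ 0) (hδ : IsThueMorse d δ)
    (hx : p m δ (m + 1) = x) (hx3 : 3 ≤ x) (z : ℂ) {n : ℕ} {r : ℝ} (hr : r ≤ 1 / x ^ n) :
    naturalMeasure m δ (closedBall z r) ≤ ENNReal.ofReal
      (((Finset.range ((m + 1) ^ n)).filter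
        fun k => dist z (vertex m δ n k) ≤ ((m : ℝ) + 1) / x ^ n).card *
          (1 / ((m : ℝ) + 1) ^ n)) := by
  rw [naturalMeasure_apply hm hδ hx hx3 isClosed_closedBall.measurableSet]
  set I := (Finset.range ((m + 1) ^ n)).filter
        fun k => dist z (vertex m δ n k) ≤ ((m : ℝ) + 1) / x ^ n
  have hsub : curve m δ ⁻¹' closedBall z r ∩ Set.Ico 0 1 ⊆ ⋃ k ∈ I, addressInterval m n k := by
    rintro t ⟨ht, ht0, ht1⟩
    refine Set.mem_iUnion₂.2 ⟨address m n t, ?_, (mem_addressInterval ht0).2 rfl⟩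
    refine Finset.mem_filter.2 ⟨Finset.mem_range.2 (address_lt ht1 n), ?_⟩
    have h1 := dist_curve_vertex hm hδ hx hx3 n t
    have h2 : dist (curve m δ t) z ≤ r := ht
    calc _ ≤ dist (curve m δ t) z + dist (curve m δ t) (vertex m δ n (address m n t)) :=
          dist_triangle_left _ _ _
      _ ≤ 1 / x ^ n + m / x ^ n := add_le_add (h2.trans hr) h1
      _ = _ := by ring
  calc _ ≤ volume (⋃ k ∈ I, addressInterval m n k) := measure_mono hsub
    _ ≤ ∑ k ∈ I, volume (addressInterval m n k) := measure_biUnion_finset_le _ _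
    _ = _ := by
      simp only [volume_addressInterval]
      rw [Finset.sum_const, nsmul_eq_mul, ENNReal.ofReal_mul (Nat.cast_nonneg _),
        ENNReal.ofReal_natCast]

/-- The vertex of level n approximating z is within m / x^n both of z and of all curve points with
its address, so the ball receives a whole address interval. -/
theorem le_naturalMeasure_closedBall (hm : m ≠ 0) (hδ : IsThueMorse d δ)
    (hx : p m δ (m + 1) = x) (hx3 : 3 ≤ x) {z : ℂ} (hz : z ∈ limitSet m δ x) {n : ℕ} {r : ℝ}
    (hr : 2 * m / x ^ n ≤ r) :
    ENNReal.ofReal (1 / ((m : ℝ) + 1) ^ n) ≤ naturalMeasure m δ (closedBall z r) := by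
  rw [naturalMeasure_apply hm hδ hx hx3 isClosed_closedBall.measurableSet]
  obtain ⟨k, hk, hzk⟩ := hz n
  rw [← volume_addressInterval n k]
  refine measure_mono fun t ht => ?_
  have ht01 := addressInterval_subset hk ht
  refine ⟨?_, ht01⟩
  have h1 := dist_curve_vertex hm hδ hx hx3 n t
  rw [(mem_addressInterval ht01.1).1 ht] at h1
  change dist _ _ ≤ r
  calc _ ≤ dist (curve m δ t) (vertex m δ n k) + dist z (vertex m δ n k) :=
        dist_triangle_right _ _ _
    _ ≤ m / x ^ n + m / x ^ n := add_le_add h1 hzk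
    _ = 2 * m / x ^ n := by ring
    _ ≤ r := hr

/-- The natural measure is Ahlfors regular, if the open set condition holds. -/
theorem isAhlforsRegular_naturalMeasure (hm : m ≠ 0) (hδ : IsThueMorse d δ)
    (hx : p m δ (m + 1) = x) (hx3 : 3 ≤ x) (hosc : OpenSetCondition (ifs m δ)) :
    ∃ c C : ℝ, IsAhlforsRegular (naturalMeasure m δ) (limitSet m δ x)
      (Real.log ((m : ℝ) + 1) / Real.log x) c C := by
  have hx0 : 0 < x := by linarith
  have hx1 : 1 < x := by linarith
  have hm1 : (1 : ℝ) ≤ m := by exact_mod_cast Nat.one_le_iff_ne_zero.2 hm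
  obtain ⟨M, hM, hcard⟩ := exists_card_vertex_le hm hδ hx hx3 hosc
  set s := Real.log ((m : ℝ) + 1) / Real.log x with hs
  have hlogx : 0 < Real.log x := Real.log_pos hx1
  have hs0 : 0 < s := div_pos (Real.log_pos (by linarith)) hlogx
  have hxs : x ^ s = (m : ℝ) + 1 := by
    rw [Real.rpow_def_of_pos hx0, hs, mul_div_cancel₀ _ hlogx.ne', Real.exp_log (by positivity)]
  have hpow : ∀ n : ℕ, (1 / x ^ n) ^ s = 1 / ((m : ℝ) + 1) ^ n := by
    intro n
    rw [Real.div_rpow zero_le_one (by positivity), Real.one_rpow, ← hxs, ← Real.rpow_natCast,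
      ← Real.rpow_natCast, ← Real.rpow_mul hx0.le, ← Real.rpow_mul hx0.le, mul_comm]
  have hnear : ∀ r : ℝ, 0 < r → r ≤ 1 → ∃ n : ℕ, 1 / x ^ (n + 1) < r ∧ r ≤ 1 / x ^ n := by
    intro r hr0 hr1
    obtain ⟨n, h1, h2⟩ := exists_nat_pow_near_of_lt_one hr0 hr1 (inv_pos.2 hx0) (inv_lt_one_of_one_lt₀ hx1)
    exact ⟨n, by simpa using h1, by simpa using h2⟩
  refine ⟨1 / ((2 * m) ^ s * ((m : ℝ) + 1)), M * ((m : ℝ) + 1), by positivity, by positivity, hs0,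
    ?_, ?_, ?_, ?_⟩
  · rw [naturalMeasure_apply hm hδ hx hx3 MeasurableSet.univ]
    simp
  · rw [naturalMeasure_apply hm hδ hx hx3 isCompact_limitSet.isClosed.measurableSet.compl]
    have : curve m δ ⁻¹' (limitSet m δ x)ᶜ ∩ Set.Ico 0 1 = ∅ := by
      rw [Set.eq_empty_iff_forall_notMem]
      rintro t ⟨ht, ht1⟩
      exact ht (curve_mem_limitSet hm hδ hx hx3 ht1.2)
    rw [this, measure_empty]
  · intro z hz r hr0 hr1
    -- The scale is chosen so that 2 m / x^(n+1) < r, the radius that captures an address interval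
    -- of level n + 1.
    obtain ⟨n, h1, h2⟩ := hnear (r / (2 * m)) (by positivity)
      (by rw [div_le_one (by positivity)]; linarith)
    refine le_trans (ENNReal.ofReal_le_ofReal ?_)
      (le_naturalMeasure_closedBall hm hδ hx hx3 hz (n := n + 1) (r := r) ?_)
    · have h3 := Real.rpow_le_rpow (by positivity) h2 hs0.le
      rw [hpow, Real.div_rpow hr0.le (by positivity)] at h3
      calc 1 / ((2 * m) ^ s * ((m : ℝ) + 1)) * r ^ s = r ^ s / (2 * m) ^ s * (1 / ((m : ℝ) + 1)) := by
            rw [div_mul_div_comm, mul_one, div_mul_eq_mul_div, one_mul]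
        _ ≤ 1 / ((m : ℝ) + 1) ^ n * (1 / ((m : ℝ) + 1)) := by gcongr
        _ = _ := by rw [pow_succ, div_mul_div_comm, one_mul]
    · rw [lt_div_iff₀ (by positivity)] at h1
      refine le_trans (le_of_eq ?_) h1.le
      ring
  · intro z r hr0 hr1
    obtain ⟨n, h1, h2⟩ := hnear r hr0 hr1
    refine (naturalMeasure_closedBall_le hm hδ hx hx3 z h2).trans (ENNReal.ofReal_le_ofReal ?_)
    have h3 := Real.rpow_le_rpow (by positivity) h1.le hs0.le
    rw [hpow, pow_succ, div_le_iff₀ (by positivity)] at h3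
    calc _ ≤ M * (1 / ((m : ℝ) + 1) ^ n) := by
          gcongr
          exact hcard n z
      _ ≤ M * (((m : ℝ) + 1) * r ^ s) := by
          gcongr
          rw [div_le_iff₀ (by positivity)]
          linarith
      _ = _ := by ring

end NaturalMeasure

/-! ### The directions that are multiples of `π / (2m)` -/

/-- The unit vector in the direction `nπ/(2m)`. -/
noncomputable def dir (m : ℕ) (n : ℤ) : ℂ :=
  Complex.exp (((n : ℝ) * Real.pi / (2 * m) : ℝ) * Complex.I)

/-- The sine of `nπ/(2m)`. -/
noncomputable def sn (m : ℕ) (n : ℤ) : ℝ := Real.sin ((n : ℝ) * Real.pi / (2 * m))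

/-- The distance from the centre of the regular `m`-gon of side length `1` to its vertices. -/
noncomputable def circumradius (m : ℕ) : ℝ := (2 * sn m 2)⁻¹

/-- The coordinate of `z` in the direction `-nπ/(2m)`. -/
noncomputable def coord (m : ℕ) (n : ℤ) (z : ℂ) : ℝ := (dir m n * z).re

section Directions

variable {m : ℕ}

theorem dir_add (m : ℕ) (a b : ℤ) : dir m (a + b) = dir m a * dir m b := by
  rw [dir, dir, dir, ← Complex.exp_add]
  congr 1
  push_cast
  ring

theorem dir_zero (m : ℕ) : dir m 0 = 1 := by simp [dir]

theorem norm_dir (m : ℕ) (n : ℤ) : ‖dir m n‖ = 1 := Complex.norm_exp_ofReal_mul_I _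

theorem dir_self (hm : m ≠ 0) : dir m m = Complex.I := by
  have hm' : (m : ℝ) ≠ 0 := Nat.cast_ne_zero.2 hm
  have h : ((m : ℤ) : ℝ) * Real.pi / (2 * m) = Real.pi / 2 := by
    push_cast
    field_simp
  rw [dir, h]
  push_cast
  exact Complex.exp_pi_div_two_mul_I

theorem dir_two_mul (hm : m ≠ 0) : dir m (2 * m) = -1 := by
  rw [two_mul, dir_add, dir_self hm, Complex.I_mul_I]

theorem dir_add_two_mul (hm : m ≠ 0) (n : ℤ) : dir m (n + 2 * m) = -dir m n := by
  rw [dir_add, dir_two_mul hm, mul_neg_one]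

theorem dir_neg (m : ℕ) (n : ℤ) : dir m (-n) = (starRingEnd ℂ) (dir m n) := by
  rw [dir, dir, ← Complex.exp_conj]
  congr 1
  simp only [map_mul, Complex.conj_ofReal, Complex.conj_I]
  push_cast
  ring

theorem dir_im (m : ℕ) (n : ℤ) : (dir m n).im = sn m n := by
  rw [dir, sn, Complex.exp_ofReal_mul_I_im]

theorem dir_re (hm : m ≠ 0) (n : ℤ) : (dir m n).re = sn m (n + m) := by
  rw [← dir_im, dir_add, dir_self hm]
  simp

theorem sn_neg (m : ℕ) (n : ℤ) : sn m (-n) = -sn m n := by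
  rw [← dir_im, dir_neg, Complex.conj_im, dir_im]

theorem sn_zero (m : ℕ) : sn m 0 = 0 := by simp [sn]

theorem sn_self (hm : m ≠ 0) : sn m m = 1 := by
  rw [← dir_im, dir_self hm, Complex.I_im]

theorem sn_add_two_mul (hm : m ≠ 0) (n : ℤ) : sn m (n + 2 * m) = -sn m n := by
  rw [← dir_im, dir_add_two_mul hm, Complex.neg_im, dir_im]

theorem sn_sub_two_mul (hm : m ≠ 0) (n : ℤ) : sn m (n - 2 * m) = -sn m n := by
  have := sn_add_two_mul hm (n - 2 * m)
  rw [sub_add_cancel] at this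
  rw [this, neg_neg]

theorem sn_two_mul_sub (hm : m ≠ 0) (n : ℤ) : sn m (2 * m - n) = sn m n := by
  rw [show (2 * m - n : ℤ) = -(n - 2 * m) by ring, sn_neg, sn_sub_two_mul hm, neg_neg]

theorem sn_four_mul_sub (hm : m ≠ 0) (n : ℤ) : sn m (4 * m - n) = -sn m n := by
  rw [show (4 * m - n : ℤ) = 2 * m - (n - 2 * m) by ring, sn_two_mul_sub hm, sn_sub_two_mul hm]

/-- The sine at `b` is not less than at `a`, if `b` is nearer to the quarter period. -/
theorem sn_le (hm : m ≠ 0) {a b : ℤ}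
    (h : (0 ≤ a + b - 2 * m ∧ a + b - 2 * m ≤ 4 * m ∧ 0 ≤ a - b ∧ a - b ≤ 4 * m) ∨
      (-(4 * m) ≤ a + b - 2 * m ∧ a + b - 2 * m ≤ 0 ∧ -(4 * m) ≤ a - b ∧ a - b ≤ 0)) :
    sn m a ≤ sn m b := by
  have hm' : (0 : ℝ) < m := Nat.cast_pos.2 (Nat.pos_of_ne_zero hm)
  have hπ := Real.pi_pos
  -- The sum-to-product formula, with the cosine shifted to a sine by π/2. The signs of both factors
  -- are then read off from the ranges of two integers.
  have key : sn m b - sn m a = 2 * Real.sin (((a + b - 2 * m : ℤ) : ℝ) * (Real.pi / (4 * m))) *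
      Real.sin (((a - b : ℤ) : ℝ) * (Real.pi / (4 * m))) := by
    have hrw : ((a + b - 2 * m : ℤ) : ℝ) * (Real.pi / (4 * m)) =
        ((b : ℝ) * Real.pi / (2 * m) + (a : ℝ) * Real.pi / (2 * m)) / 2 - Real.pi / 2 := by
      push_cast
      field_simp
      ring
    have hrw' : ((a - b : ℤ) : ℝ) * (Real.pi / (4 * m)) =
        -(((b : ℝ) * Real.pi / (2 * m) - (a : ℝ) * Real.pi / (2 * m)) / 2) := by
      push_cast
      field_simp
      ring
    rw [sn, sn, Real.sin_sub_sin, hrw, hrw', Real.sin_sub_pi_div_two, Real.sin_neg]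
    ring
  have hpos : ∀ n : ℤ, 0 ≤ n → n ≤ 4 * m → 0 ≤ Real.sin ((n : ℝ) * (Real.pi / (4 * m))) := by
    intro n h0 h1
    have h0' : (0 : ℝ) ≤ n := by exact_mod_cast h0
    have h1' : (n : ℝ) ≤ 4 * m := by exact_mod_cast h1
    refine Real.sin_nonneg_of_nonneg_of_le_pi (by positivity) ?_
    rw [mul_div_assoc', div_le_iff₀ (by positivity)]
    nlinarith
  have hneg : ∀ n : ℤ, -(4 * m) ≤ n → n ≤ 0 → Real.sin ((n : ℝ) * (Real.pi / (4 * m))) ≤ 0 := by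
    intro n h0 h1
    have := hpos (-n) (by omega) (by omega)
    rw [Int.cast_neg, neg_mul, Real.sin_neg] at this
    linarith
  rcases h with ⟨h1, h2, h3, h4⟩ | ⟨h1, h2, h3, h4⟩
  · have := mul_nonneg (hpos _ h1 h2) (hpos _ h3 h4)
    linarith
  · have := mul_nonneg_of_nonpos_of_nonpos (hneg _ h1 h2) (hneg _ h3 h4)
    linarith

theorem sn_nonneg (hm : m ≠ 0) {n : ℤ} (h0 : 0 ≤ n) (h1 : n ≤ 2 * m) : 0 ≤ sn m n := by
  rw [← sn_zero m]
  exact sn_le hm (by omega)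

theorem sn_pos (hm : m ≠ 0) {n : ℤ} (h0 : 0 < n) (h1 : n < 2 * m) : 0 < sn m n := by
  have hm' : (0 : ℝ) < m := Nat.cast_pos.2 (Nat.pos_of_ne_zero hm)
  have h0' : (0 : ℝ) < n := by exact_mod_cast h0
  have h1' : (n : ℝ) < 2 * m := by exact_mod_cast h1
  refine Real.sin_pos_of_pos_of_lt_pi (by positivity) ?_
  rw [div_lt_iff₀ (by positivity)]
  nlinarith [Real.pi_pos]

theorem circumradius_pos (hm : 2 ≤ m) : 0 < circumradius m :=
  inv_pos.2 (mul_pos two_pos (sn_pos (by omega) (by omega) (by omega)))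

theorem circumradius_mul_sn (hm : 2 ≤ m) : circumradius m * sn m 2 = 1 / 2 := by
  have h : sn m 2 ≠ 0 := (sn_pos (by omega) (by omega) (by omega)).ne'
  rw [circumradius]
  field_simp

/-- A side of the regular `m`-gon is the difference of two of the vectors from the centre to the
vertices. -/
theorem circumradius_mul_sub (hm : 2 ≤ m) (n : ℤ) :
    (circumradius m : ℂ) * (dir m (n + 2 - m) - dir m (n - 2 - m)) = dir m n := by
  have hm0 : m ≠ 0 := by omega
  have h2 : dir m 2 - dir m (-2) = 2 * sn m 2 * Complex.I := by
    rw [dir_neg, Complex.sub_conj, dir_im]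
    push_cast
    ring
  have h3 : dir m (-m) = -Complex.I := by rw [dir_neg, dir_self hm0, Complex.conj_I]
  have h4 : (circumradius m : ℂ) * sn m 2 = 1 / 2 := by
    rw [← Complex.ofReal_mul, circumradius_mul_sn hm]
    norm_num
  rw [show n + 2 - m = n + (-m) + 2 by ring, show n - 2 - m = n + (-m) + (-2) by ring, dir_add,
    dir_add m (n + -m), ← mul_sub, h2, dir_add, h3]
  linear_combination (dir m n * 2) * h4 -
    (dir m n * 2 * circumradius m * sn m 2) * Complex.I_mul_I

theorem coord_add (n : ℤ) (z w : ℂ) : coord m n (z + w) = coord m n z + coord m n w := by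
  rw [coord, mul_add, Complex.add_re, coord, coord]

theorem coord_sub (n : ℤ) (z w : ℂ) : coord m n (z - w) = coord m n z - coord m n w := by
  rw [coord, mul_sub, Complex.sub_re, coord, coord]

theorem coord_real_mul (n : ℤ) (r : ℝ) (z : ℂ) : coord m n (r * z) = r * coord m n z := by
  rw [coord, mul_left_comm, Complex.re_ofReal_mul, coord]

theorem coord_dir (hm : m ≠ 0) (n k : ℤ) : coord m n (dir m k) = sn m (n + k + m) := by
  rw [coord, ← dir_add, dir_re hm]

theorem coord_vector (hm : m ≠ 0) (n u : ℤ) :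
    coord m n (circumradius m * dir m (2 * u - m)) = circumradius m * sn m (n + 2 * u) := by
  rw [coord_real_mul, coord_dir hm]
  congr 2
  ring

end Directions

/-! ### The first `m + 2` points -/

section Arcs

variable {m : ℕ} {δ : ℕ → ℤˣ}

theorem step_eq (hm : m ≠ 0) (hδ : IsThueMorse (quarterBlock m) δ) {k : ℕ} (hk : k ≤ m) :
    step m δ k = if k ≤ m / 4 ∨ m - m / 4 ≤ k then dir m (4 * k) else -dir m (4 * k) := by
  have hm' : (m : ℂ) ≠ 0 := Nat.cast_ne_zero.2 hm
  have hexp : Complex.exp (2 * (k : ℂ) * (Real.pi : ℂ) * Complex.I / (m : ℂ)) = dir m (4 * k) := by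
    rw [dir]
    congr 1
    push_cast
    field_simp
    ring
  rw [step, hexp, hδ.apply_of_lt (Nat.lt_succ_of_le hk), quarterBlock]
  split_ifs with h <;> simp

/-- The block of signs is a palindrome and m - k turns by the angle opposite to that of k. -/
theorem conj_step (hm : m ≠ 0) (hδ : IsThueMorse (quarterBlock m) δ) {k : ℕ} (hk : k ≤ m) :
    (starRingEnd ℂ) (step m δ k) = step m δ (m - k) := by
  have hdir : dir m (4 * (m - k : ℕ)) = (starRingEnd ℂ) (dir m (4 * k)) := by
    rw [← dir_neg, Nat.cast_sub hk,
      show (4 * ((m : ℤ) - k) : ℤ) = -(4 * k) + 2 * m + 2 * m by ring, dir_add_two_mul hm,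
      dir_add_two_mul hm, neg_neg]
  rw [step_eq hm hδ hk, step_eq hm hδ (Nat.sub_le m k), hdir]
  have hiff : (k ≤ m / 4 ∨ m - m / 4 ≤ k) ↔ (m - k ≤ m / 4 ∨ m - m / 4 ≤ m - k) := by omega
  by_cases h : k ≤ m / 4 ∨ m - m / 4 ≤ k
  · rw [if_pos h, if_pos (hiff.1 h)]
  · rw [if_neg h, if_neg (fun h' => h (hiff.2 h')), map_neg]

/-- The polygonal line is symmetric about a vertical axis once its end point is known to be real,
which is the case j = m + 1. -/
theorem conj_p (hm : m ≠ 0) (hδ : IsThueMorse (quarterBlock m) δ) {j : ℕ} (hj : j ≤ m + 1) :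
    (starRingEnd ℂ) (p m δ j) = p m δ (m + 1) - p m δ (m + 1 - j) := by
  induction j with
  | zero => simp [p_zero]
  | succ j ih =>
    have h1 : m + 1 - j = (m + 1 - (j + 1)) + 1 := by omega
    have h2 : m - j = m + 1 - (j + 1) := by omega
    rw [p_succ, map_add, ih (by omega), conj_step hm hδ (by omega), h1, p_succ m δ (m + 1 - (j + 1)), h2]
    ring

/-- The centre of the regular polygon on which the first arc of the polygonal line lies. -/
noncomputable def centre₁ (m : ℕ) : ℂ := circumradius m * dir m (m - 2)

/-- The centre of the regular polygon on which the second arc of the polygonal line lies. -/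
noncomputable def centre₂ (m : ℕ) : ℂ :=
  centre₁ m + 2 * (circumradius m * dir m (2 * (2 * (m / 4 : ℕ) + 1) - m))

/-- The centre of the regular polygon on which the third arc of the polygonal line lies. -/
noncomputable def centre₃ (m : ℕ) : ℂ :=
  centre₂ m - 2 * (circumradius m * dir m (2 * (2 * m - 2 * (m / 4 : ℕ) - 1) - m))

/-- By `circumradius_mul_sub` each step is the difference of two radii of the m-gon, so the sum
telescopes. The other two arcs work alike, with the radius reversed on the second. -/
theorem p_arc₁ (hm : 2 ≤ m) (hδ : IsThueMorse (quarterBlock m) δ) {j : ℕ} (hj : j ≤ m / 4 + 1) :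
    p m δ j = centre₁ m + circumradius m * dir m (2 * (2 * j - 1) - m) := by
  induction j with
  | zero =>
    have : dir m (m - 2) = -dir m (2 * (2 * (0 : ℕ) - 1) - m) := by
      rw [← dir_add_two_mul (by omega)]
      congr 1
      push_cast
      ring
    rw [p_zero, centre₁, this]
    ring
  | succ j ih =>
    have h := circumradius_mul_sub hm (4 * j)
    rw [p_succ, ih (by omega), step_eq (by omega) hδ (by omega), if_pos (by omega), ← h,
      show (2 * (2 * ((j + 1 : ℕ) : ℤ) - 1) - m) = 4 * j + 2 - m by push_cast; ring,
      show (2 * (2 * (j : ℤ) - 1) - m) = 4 * j - 2 - m by ring]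
    ring

theorem p_arc₂ (hm : 2 ≤ m) (hδ : IsThueMorse (quarterBlock m) δ) {j : ℕ} (hj : m / 4 + 1 ≤ j)
    (hj' : j ≤ m - m / 4) :
    p m δ j = centre₂ m - circumradius m * dir m (2 * (2 * j - 1) - m) := by
  induction j, hj using Nat.le_induction with
  | base =>
    rw [p_arc₁ hm hδ le_rfl, centre₂,
      show (2 * (2 * ((m / 4 + 1 : ℕ) : ℤ) - 1) - m) = 2 * (2 * (m / 4 : ℕ) + 1) - m by
        push_cast; ring]
    ring
  | succ j hj ih =>
    have h := circumradius_mul_sub hm (4 * j)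
    rw [p_succ, ih (by omega), step_eq (by omega) hδ (by omega), if_neg (by omega), ← h,
      show (2 * (2 * ((j + 1 : ℕ) : ℤ) - 1) - m) = 4 * j + 2 - m by push_cast; ring,
      show (2 * (2 * (j : ℤ) - 1) - m) = 4 * j - 2 - m by ring]
    ring

theorem p_arc₃ (hm : 2 ≤ m) (hδ : IsThueMorse (quarterBlock m) δ) {j : ℕ} (hj : m - m / 4 ≤ j)
    (hj' : j ≤ m + 1) :
    p m δ j = centre₃ m + circumradius m * dir m (2 * (2 * j - 1) - m) := by
  induction j, hj using Nat.le_induction with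
  | base =>
    rw [p_arc₂ hm hδ (by omega) le_rfl, centre₃, Nat.cast_sub (by omega),
      show (2 * (2 * ((m : ℤ) - (m / 4 : ℕ)) - 1) - m) =
        2 * (2 * (m : ℤ) - 2 * (m / 4 : ℕ) - 1) - m by ring]
    ring
  | succ j hj ih =>
    have h := circumradius_mul_sub hm (4 * j)
    rw [p_succ, ih (by omega), step_eq (by omega) hδ (by omega), if_pos (by omega), ← h,
      show (2 * (2 * ((j + 1 : ℕ) : ℤ) - 1) - m) = 4 * j + 2 - m by push_cast; ring,
      show (2 * (2 * (j : ℤ) - 1) - m) = 4 * j - 2 - m by ring]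
    ring

theorem coord_centre₁ (hm : m ≠ 0) (n : ℤ) :
    coord m n (centre₁ m) = circumradius m * -sn m (n - 2) := by
  rw [centre₁, coord_real_mul, coord_dir hm, ← sn_add_two_mul hm]
  congr 2
  ring

theorem coord_centre₂ (hm : m ≠ 0) (n : ℤ) :
    coord m n (centre₂ m) =
      circumradius m * (-sn m (n - 2) + 2 * sn m (n + 2 * (2 * (m / 4 : ℕ) + 1))) := by
  rw [centre₂, two_mul, coord_add, coord_add, coord_centre₁ hm, coord_vector hm]
  ring

theorem coord_centre₃ (hm : m ≠ 0) (n : ℤ) :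
    coord m n (centre₃ m) =
      circumradius m * (-sn m (n - 2) + 2 * sn m (n + 2 * (2 * (m / 4 : ℕ) + 1)) +
        2 * sn m (2 * (2 * (m / 4 : ℕ) + 1) - n)) := by
  have h : sn m (2 * (2 * (m / 4 : ℕ) + 1) - n) =
      -sn m (n + 2 * (2 * m - 2 * (m / 4 : ℕ) - 1)) := by
    rw [← sn_four_mul_sub hm]
    congr 1
    ring
  rw [centre₃, two_mul, coord_sub, coord_add, coord_centre₂ hm, coord_vector hm, h]
  ring

theorem exists_real_p (hm : 2 ≤ m) (hδ : IsThueMorse (quarterBlock m) δ) :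
    ∃ x : ℝ, p m δ (m + 1) = x ∧ 3 ≤ x ∧ x ≤ (m : ℝ) + 1 := by
  have hm0 : m ≠ 0 := by omega
  have hconj := conj_p hm0 hδ le_rfl
  rw [Nat.sub_self, p_zero, sub_zero] at hconj
  obtain ⟨x, hx⟩ := Complex.conj_eq_iff_real.1 hconj
  refine ⟨x, hx, ?_, ?_⟩
  · have hre : x = coord m 0 (p m δ (m + 1)) := by
      rw [hx, coord, dir_zero, one_mul, Complex.ofReal_re]
    rw [p_arc₃ hm hδ (by omega) le_rfl, coord_add, coord_centre₃ hm0, coord_vector hm0] at hre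
    have h1 : sn m (0 + 2 * (2 * ((m + 1 : ℕ) : ℤ) - 1)) = sn m 2 := by
      rw [show (0 + 2 * (2 * ((m + 1 : ℕ) : ℤ) - 1)) = 2 + 2 * m + 2 * m by push_cast; ring,
        sn_add_two_mul hm0, sn_add_two_mul hm0, neg_neg]
    have h2 : sn m (0 - 2) = -sn m 2 := by rw [zero_sub, sn_neg]
    have h3 : sn m 2 ≤ sn m (2 * (2 * (m / 4 : ℕ) + 1)) := sn_le hm0 (by omega)
    rw [h1, h2, zero_add, sub_zero] at hre
    have h4 := circumradius_mul_sn hm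
    -- With R the circumradius and S = `sn m (2 * (2 * (m / 4) + 1))`, x = R (2 `sn m 2` + 4 S) ≥ 6
    -- R `sn m 2` = 3.
    have h5 := mul_le_mul_of_nonneg_left h3 (circumradius_pos hm).le
    nlinarith
  · have h := norm_p_le m δ (m + 1)
    rw [hx, Complex.norm_real] at h
    exact (le_abs_self x).trans (by exact_mod_cast h)

end Arcs

/-! ### The corners of the kite and of its copies -/

/-- The corners of a triangle with base `[0, 1]` (if `m % 4 ≠ 3`) or of a kite with diagonal
`[0, 1]` (if `m % 4 = 3`). -/
def corners (m : ℕ) : Set ℂ :=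
  {w | w = 0 ∨ w = 1 ∨ w = centre₁ m ∨
    m % 4 = 3 ∧ w = centre₁ m + circumradius m * dir m (-m)}

/-- The copy of the plane attached to the `j`-th edge of the polygonal line. -/
noncomputable def edgeMap (m : ℕ) (δ : ℕ → ℤˣ) (j : ℕ) (z : ℂ) : ℂ := p m δ j + step m δ j * z

/-- The directions, as multiples of `π/m`, in which the corners of the copy of the kite on the
`j`-th edge lie. -/
def IsCornerIndex (m j : ℕ) (u : ℤ) : Prop :=
  u = 2 * j - 1 ∨ u = 2 * j + 1 ∨ m % 4 = 3 ∧ u = 2 * j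

section Corners

variable {m : ℕ} {δ : ℕ → ℤˣ} {P : ℂ → Prop} {j : ℕ}

theorem edgeMap_one (j : ℕ) : edgeMap m δ j 1 = p m δ (j + 1) := by
  rw [edgeMap, mul_one, p_succ]

theorem dir_mul_centre₁ (hm : 2 ≤ m) (j : ℕ) :
    dir m (4 * j) * centre₁ m = -(circumradius m * dir m (2 * (2 * j - 1) - m)) := by
  rw [centre₁, mul_left_comm, ← dir_add, ← mul_neg, ← dir_add_two_mul (by omega)]
  congr 2
  ring

theorem dir_mul_bottom (j : ℕ) : dir m (4 * j) * ((circumradius m : ℂ) * dir m (-m)) =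
    circumradius m * dir m (2 * (2 * j) - m) := by
  rw [mul_left_comm, ← dir_add]
  congr 2
  ring

/-- The copy of `centre₁` on any edge of the arc is the centre of the arc itself, and the other
corners fall on the circumcircle. Claims about a copy thus become claims about sines at the indices
u. -/
theorem forall_corner₁ (hm : 2 ≤ m) (hδ : IsThueMorse (quarterBlock m) δ) (hj : j ≤ m / 4)
    (hc : P (centre₁ m))
    (hu : ∀ u, IsCornerIndex m j u → P (centre₁ m + circumradius m * dir m (2 * u - m))) :
    ∀ w ∈ corners m, P (edgeMap m δ j w) := by
  have hpj := p_arc₁ hm hδ (by omega : j ≤ m / 4 + 1)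
  rintro w (rfl | rfl | rfl | ⟨h3, rfl⟩)
  · rw [edgeMap, mul_zero, add_zero, hpj]
    exact hu _ (Or.inl rfl)
  · rw [edgeMap_one, p_arc₁ hm hδ (by omega)]
    exact hu _ (Or.inr (Or.inl (by push_cast; ring)))
  · rw [edgeMap, hpj, step_eq (by omega) hδ (by omega), if_pos (by omega), dir_mul_centre₁ hm,
      add_neg_cancel_right]
    exact hc
  · rw [edgeMap, hpj, step_eq (by omega) hδ (by omega), if_pos (by omega), mul_add,
      dir_mul_centre₁ hm, dir_mul_bottom, ← add_assoc, add_neg_cancel_right]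
    exact hu _ (Or.inr (Or.inr ⟨h3, rfl⟩))

theorem forall_corner₂ (hm : 2 ≤ m) (hδ : IsThueMorse (quarterBlock m) δ) (hj : m / 4 < j)
    (hj' : j < m - m / 4) (hc : P (centre₂ m))
    (hu : ∀ u, IsCornerIndex m j u → P (centre₂ m - circumradius m * dir m (2 * u - m))) :
    ∀ w ∈ corners m, P (edgeMap m δ j w) := by
  have hpj := p_arc₂ hm hδ (by omega : m / 4 + 1 ≤ j) (by omega)
  rintro w (rfl | rfl | rfl | ⟨h3, rfl⟩)
  · rw [edgeMap, mul_zero, add_zero, hpj]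
    exact hu _ (Or.inl rfl)
  · rw [edgeMap_one, p_arc₂ hm hδ (by omega) (by omega)]
    exact hu _ (Or.inr (Or.inl (by push_cast; ring)))
  · rw [edgeMap, hpj, step_eq (by omega) hδ (by omega), if_neg (by omega), neg_mul,
      dir_mul_centre₁ hm, neg_neg, sub_add_cancel]
    exact hc
  · rw [edgeMap, hpj, step_eq (by omega) hδ (by omega), if_neg (by omega), mul_add, neg_mul,
      neg_mul, dir_mul_centre₁ hm, neg_neg, dir_mul_bottom, ← add_assoc, sub_add_cancel,
      ← sub_eq_add_neg]
    exact hu _ (Or.inr (Or.inr ⟨h3, rfl⟩))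

theorem forall_corner₃ (hm : 2 ≤ m) (hδ : IsThueMorse (quarterBlock m) δ) (hj : m - m / 4 ≤ j)
    (hj' : j ≤ m) (hc : P (centre₃ m))
    (hu : ∀ u, IsCornerIndex m j u → P (centre₃ m + circumradius m * dir m (2 * u - m))) :
    ∀ w ∈ corners m, P (edgeMap m δ j w) := by
  have hpj := p_arc₃ hm hδ hj (by omega)
  rintro w (rfl | rfl | rfl | ⟨h3, rfl⟩)
  · rw [edgeMap, mul_zero, add_zero, hpj]
    exact hu _ (Or.inl rfl)
  · rw [edgeMap_one, p_arc₃ hm hδ (by omega) (by omega)]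
    exact hu _ (Or.inr (Or.inl (by push_cast; ring)))
  · rw [edgeMap, hpj, step_eq (by omega) hδ (by omega), if_pos (by omega), dir_mul_centre₁ hm,
      add_neg_cancel_right]
    exact hc
  · rw [edgeMap, hpj, step_eq (by omega) hδ (by omega), if_pos (by omega), mul_add,
      dir_mul_centre₁ hm, dir_mul_bottom, ← add_assoc, add_neg_cancel_right]
    exact hu _ (Or.inr (Or.inr ⟨h3, rfl⟩))

/-! ### Separation of the copies by lines -/

/-- The sine vanishes at u = 2 k - 1, so the separating line joins the centre to the first vertex of
edge k. The bound on k - i keeps both sectors within a half-turn of that vertex. -/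
theorem separated_same_arc (hm : 2 ≤ m) {i k : ℕ} (hik : i < k) (hk : 2 * (k - i) ≤ m) {u : ℤ} :
    (IsCornerIndex m i u → sn m (-(2 * (2 * k - 1)) + 2 * u) ≤ 0) ∧
      (IsCornerIndex m k u → 0 ≤ sn m (-(2 * (2 * k - 1)) + 2 * u)) := by
  have hm0 : m ≠ 0 := by omega
  refine ⟨fun hu => ?_, fun hu => sn_nonneg hm0 ?_ ?_⟩
  · rw [← sn_zero m]
    unfold IsCornerIndex at hu
    refine sn_le hm0 ?_
    omega
  · unfold IsCornerIndex at hu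
    omega
  · unfold IsCornerIndex at hu
    omega

theorem exists_separation_same_arc (hm : 2 ≤ m) (hδ : IsThueMorse (quarterBlock m) δ) {i k : ℕ}
    (hik : i < k) (hk : k ≤ m)
    (harc : k ≤ m / 4 ∨ m / 4 < i ∧ k < m - m / 4 ∨ m - m / 4 ≤ i) :
    ∃ (n : ℤ) (κ : ℝ),
      ((∀ w ∈ corners m, coord m n (edgeMap m δ i w) ≤ κ) ∧
        ∀ w ∈ corners m, κ ≤ coord m n (edgeMap m δ k w)) ∨
      ((∀ w ∈ corners m, κ ≤ coord m n (edgeMap m δ i w)) ∧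
        ∀ w ∈ corners m, coord m n (edgeMap m δ k w) ≤ κ) := by
  have hm0 : m ≠ 0 := by omega
  have hR := (circumradius_pos hm).le
  have h (u : ℤ) := separated_same_arc hm hik (by omega) (u := u)
  rcases harc with h1 | ⟨h2, h3⟩ | h4
  · refine ⟨-(2 * (2 * k - 1)), coord m (-(2 * (2 * k - 1))) (centre₁ m), Or.inl
      ⟨forall_corner₁ (P := fun z => coord m _ z ≤ _) hm hδ (by omega) le_rfl fun u hu => ?_,
        forall_corner₁ (P := fun z => _ ≤ coord m _ z) hm hδ h1 le_rfl fun u hu => ?_⟩⟩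
    · rw [coord_add, coord_vector hm0]
      linarith [mul_nonpos_of_nonneg_of_nonpos hR ((h u).1 hu)]
    · rw [coord_add, coord_vector hm0]
      linarith [mul_nonneg hR ((h u).2 hu)]
  -- On the second arc the radii carry a minus sign, so the two sides of the line are exchanged.
  · refine ⟨-(2 * (2 * k - 1)), coord m (-(2 * (2 * k - 1))) (centre₂ m), Or.inr
      ⟨forall_corner₂ (P := fun z => _ ≤ coord m _ z) hm hδ h2 (by omega) le_rfl fun u hu => ?_,
        forall_corner₂ (P := fun z => coord m _ z ≤ _) hm hδ (by omega) h3 le_rfl fun u hu => ?_⟩⟩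
    · rw [coord_sub, coord_vector hm0]
      linarith [mul_nonpos_of_nonneg_of_nonpos hR ((h u).1 hu)]
    · rw [coord_sub, coord_vector hm0]
      linarith [mul_nonneg hR ((h u).2 hu)]
  · refine ⟨-(2 * (2 * k - 1)), coord m (-(2 * (2 * k - 1))) (centre₃ m), Or.inl
      ⟨forall_corner₃ (P := fun z => coord m _ z ≤ _) hm hδ h4 (by omega) le_rfl fun u hu => ?_,
        forall_corner₃ (P := fun z => _ ≤ coord m _ z) hm hδ (by omega) hk le_rfl fun u hu => ?_⟩⟩
    · rw [coord_add, coord_vector hm0]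
      linarith [mul_nonpos_of_nonneg_of_nonpos hR ((h u).1 hu)]
    · rw [coord_add, coord_vector hm0]
      linarith [mul_nonneg hR ((h u).2 hu)]

/-- In units of the circumradius, this is the abscissa of the junction p(m / 4 + 1) relative to
`centre₁ m`. Among the corner indices, 2 (m / 4) + 1 is as near as possible to a quarter turn, so
the bounds below make the junctions extreme. -/
theorem sn_nonneg_peak (hm : 2 ≤ m) : 0 ≤ sn m (2 * (2 * (m / 4 : ℕ) + 1)) :=
  sn_nonneg (by omega) (by omega) (by omega)

theorem sn_le_peak₁ (hm : 2 ≤ m) (hj : j ≤ m / 4) {u : ℤ} (hu : IsCornerIndex m j u) :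
    sn m (2 * u) ≤ sn m (2 * (2 * (m / 4 : ℕ) + 1)) := by
  unfold IsCornerIndex at hu
  refine sn_le (by omega) ?_
  omega

theorem sn_le_peak₂ (hm : 2 ≤ m) (hj' : j < m - m / 4) {u : ℤ}
    (hu : IsCornerIndex m j u) : sn m (2 * u) ≤ sn m (2 * (2 * (m / 4 : ℕ) + 1)) := by
  unfold IsCornerIndex at hu
  refine sn_le (by omega) ?_
  omega

theorem neg_sn_le_peak₂ (hm : 2 ≤ m) (hj : m / 4 < j) (hj' : j < m - m / 4) {u : ℤ}
    (hu : IsCornerIndex m j u) : -sn m (2 * u) ≤ sn m (2 * (2 * (m / 4 : ℕ) + 1)) := by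
  rw [← sn_four_mul_sub (by omega)]
  unfold IsCornerIndex at hu
  refine sn_le (by omega) ?_
  omega

theorem neg_sn_le_peak₃ (hm : 2 ≤ m) (hj' : j ≤ m) {u : ℤ}
    (hu : IsCornerIndex m j u) : -sn m (2 * u) ≤ sn m (2 * (2 * (m / 4 : ℕ) + 1)) := by
  rw [← sn_four_mul_sub (by omega)]
  unfold IsCornerIndex at hu
  refine sn_le (by omega) ?_
  omega

/-- The separating lines are the verticals through the junctions p(m / 4 + 1) and p(m - m / 4). -/
theorem exists_separation_other_arc (hm : 2 ≤ m) (hδ : IsThueMorse (quarterBlock m) δ) {i k : ℕ}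
    (hk : k ≤ m) (harc : i ≤ m / 4 ∧ m / 4 < k ∨ i < m - m / 4 ∧ m - m / 4 ≤ k) :
    ∃ (n : ℤ) (κ : ℝ),
      ((∀ w ∈ corners m, coord m n (edgeMap m δ i w) ≤ κ) ∧
        ∀ w ∈ corners m, κ ≤ coord m n (edgeMap m δ k w)) := by
  have hm0 : m ≠ 0 := by omega
  have hR := circumradius_pos hm
  have hS := sn_nonneg_peak hm
  set S := sn m (2 * (2 * (m / 4 : ℕ) + 1)) with hSdef
  have hc₁ : coord m 0 (centre₁ m) = circumradius m * sn m 2 := by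
    rw [coord_centre₁ hm0, zero_sub, sn_neg, neg_neg]
  have hc₂ : coord m 0 (centre₂ m) = circumradius m * (sn m 2 + 2 * S) := by
    rw [coord_centre₂ hm0, zero_sub, sn_neg, neg_neg, zero_add]
  have hc₃ : coord m 0 (centre₃ m) = circumradius m * (sn m 2 + 4 * S) := by
    rw [coord_centre₃ hm0, zero_sub, sn_neg, neg_neg, zero_add, sub_zero, ← hSdef]
    ring
  have hle₁ : ∀ j ≤ m / 4, ∀ w ∈ corners m,
      coord m 0 (edgeMap m δ j w) ≤ circumradius m * (sn m 2 + S) := by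
    intro j hj
    refine forall_corner₁ (P := fun z => coord m 0 z ≤ _) hm hδ hj ?_ fun u hu => ?_
    · rw [hc₁]
      exact mul_le_mul_of_nonneg_left (by linarith) hR.le
    · rw [coord_add, coord_vector hm0, hc₁, ← mul_add, zero_add]
      exact mul_le_mul_of_nonneg_left (by linarith [sn_le_peak₁ hm hj hu]) hR.le
  have hge₂ : ∀ j, m / 4 < j → j < m - m / 4 → ∀ w ∈ corners m,
      circumradius m * (sn m 2 + S) ≤ coord m 0 (edgeMap m δ j w) := by
    intro j hj hj'
    refine forall_corner₂ (P := fun z => _ ≤ coord m 0 z) hm hδ hj hj' ?_ fun u hu => ?_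
    · rw [hc₂]
      exact mul_le_mul_of_nonneg_left (by linarith) hR.le
    · rw [coord_sub, coord_vector hm0, hc₂, ← mul_sub, zero_add]
      exact mul_le_mul_of_nonneg_left (by linarith [sn_le_peak₂ hm hj' hu]) hR.le
  have hle₂ : ∀ j, m / 4 < j → j < m - m / 4 → ∀ w ∈ corners m,
      coord m 0 (edgeMap m δ j w) ≤ circumradius m * (sn m 2 + 3 * S) := by
    intro j hj hj'
    refine forall_corner₂ (P := fun z => coord m 0 z ≤ _) hm hδ hj hj' ?_ fun u hu => ?_
    · rw [hc₂]
      exact mul_le_mul_of_nonneg_left (by linarith) hR.le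
    · rw [coord_sub, coord_vector hm0, hc₂, ← mul_sub, zero_add]
      exact mul_le_mul_of_nonneg_left (by linarith [neg_sn_le_peak₂ hm hj hj' hu]) hR.le
  have hge₃ : ∀ j, m - m / 4 ≤ j → j ≤ m → ∀ w ∈ corners m,
      circumradius m * (sn m 2 + 3 * S) ≤ coord m 0 (edgeMap m δ j w) := by
    intro j hj hj'
    refine forall_corner₃ (P := fun z => _ ≤ coord m 0 z) hm hδ hj hj' ?_ fun u hu => ?_
    · rw [hc₃]
      exact mul_le_mul_of_nonneg_left (by linarith) hR.le
    · rw [coord_add, coord_vector hm0, hc₃, ← mul_add, zero_add]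
      exact mul_le_mul_of_nonneg_left (by linarith [neg_sn_le_peak₃ hm hj' hu]) hR.le
  have hmono : circumradius m * (sn m 2 + S) ≤ circumradius m * (sn m 2 + 3 * S) :=
    mul_le_mul_of_nonneg_left (by linarith) hR.le
  by_cases hk3 : m - m / 4 ≤ k
  · refine ⟨0, circumradius m * (sn m 2 + 3 * S), ?_, hge₃ k hk3 hk⟩
    by_cases hi : i ≤ m / 4
    · exact fun w hw => (hle₁ i hi w hw).trans hmono
    · exact hle₂ i (by omega) (by omega)
  · exact ⟨0, circumradius m * (sn m 2 + S), hle₁ i (by omega), hge₂ k (by omega) (by omega)⟩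

/-! ### The copies lie in the enlarged kite -/

/-- The line where this coordinate vanishes passes through 0 and `centre₁ m`: it carries the upper
left side of the kite. -/
theorem coord_two_nonneg (hm : 3 ≤ m) (hδ : IsThueMorse (quarterBlock m) δ) (hj : j ≤ m) :
    ∀ w ∈ corners m, 0 ≤ coord m 2 (edgeMap m δ j w) := by
  have hm0 : m ≠ 0 := by omega
  have hm2 : 2 ≤ m := by omega
  have hR := (circumradius_pos hm2).le
  have hs : 0 ≤ sn m (2 + 2 * (2 * (m / 4 : ℕ) + 1)) := sn_nonneg hm0 (by omega) (by omega)
  have hs' : 0 ≤ sn m (2 * (2 * (m / 4 : ℕ) + 1) - 2) := sn_nonneg hm0 (by omega) (by omega)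
  have h0 : sn m (2 - 2) = 0 := by rw [sub_self, sn_zero]
  by_cases h1 : j ≤ m / 4
  · refine forall_corner₁ (P := fun z => 0 ≤ coord m 2 z) hm2 hδ h1 ?_ fun u hu => ?_
    · rw [coord_centre₁ hm0, h0, neg_zero, mul_zero]
    · rw [coord_add, coord_vector hm0, coord_centre₁ hm0, h0, neg_zero, mul_zero, zero_add]
      unfold IsCornerIndex at hu
      exact mul_nonneg hR (sn_nonneg hm0 (by omega) (by omega))
  by_cases h2 : j < m - m / 4
  · refine forall_corner₂ (P := fun z => 0 ≤ coord m 2 z) hm2 hδ (by omega) h2 ?_ fun u hu => ?_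
    · rw [coord_centre₂ hm0, h0]
      exact mul_nonneg hR (by linarith)
    · rw [coord_sub, coord_vector hm0, coord_centre₂ hm0, h0, ← mul_sub]
      have h3 : sn m (2 + 2 * u) ≤ sn m (2 + 2 * (2 * (m / 4 : ℕ) + 1)) := by
        unfold IsCornerIndex at hu
        refine sn_le hm0 ?_
        omega
      exact mul_nonneg hR (by linarith)
  · refine forall_corner₃ (P := fun z => 0 ≤ coord m 2 z) hm2 hδ (by omega) hj ?_ fun u hu => ?_
    · rw [coord_centre₃ hm0, h0]
      exact mul_nonneg hR (by linarith)
    · rw [coord_add, coord_vector hm0, coord_centre₃ hm0, h0, ← mul_add]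
      have h3 : -sn m (2 + 2 * u) ≤ sn m (2 * (2 * (m / 4 : ℕ) + 1) - 2) := by
        rw [← sn_four_mul_sub hm0]
        unfold IsCornerIndex at hu
        refine sn_le hm0 ?_
        omega
      exact mul_nonneg hR (by linarith)

theorem sn_sub_two (hm : m ≠ 0) : sn m (m - 2) = 1 - 2 * sn m 1 ^ 2 := by
  have h1 : sn m (m - 2) = sn m (2 + m) := by
    rw [← sn_two_mul_sub hm]
    congr 1
    ring
  have h2 := Complex.sq_norm (dir m 1)
  rw [norm_dir, Complex.normSq_apply] at h2
  have h3 : dir m 2 = dir m 1 * dir m 1 := by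
    rw [← dir_add]
    rfl
  rw [h1, ← dir_re hm, h3, Complex.mul_re, ← dir_im]
  linarith

/-- The coordinate is the imaginary part, so the claim is that no copy of the triangle dips below
the base. -/
theorem coord_neg_nonneg (hm : 3 ≤ m) (hm3 : m % 4 ≠ 3) (hδ : IsThueMorse (quarterBlock m) δ)
    (hj : j ≤ m) : ∀ w ∈ corners m, 0 ≤ coord m (-m) (edgeMap m δ j w) := by
  have hm0 : m ≠ 0 := by omega
  have hm2 : 2 ≤ m := by omega
  have hR := (circumradius_pos hm2).le
  have h0 : -sn m (-m - 2) = sn m (m - 2) := by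
    rw [← sn_add_two_mul hm0]
    congr 1
    ring
  have hpos : 0 ≤ sn m (m - 2) := sn_nonneg hm0 (by omega) (by omega)
  have hq : 0 ≤ sn m (-m + 2 * (2 * (m / 4 : ℕ) + 1)) := sn_nonneg hm0 (by omega) (by omega)
  have hq' : sn m (2 * (2 * (m / 4 : ℕ) + 1) - -m) = -sn m (-m + 2 * (2 * (m / 4 : ℕ) + 1)) := by
    rw [← sn_add_two_mul hm0]
    congr 1
    ring
  by_cases h1 : j ≤ m / 4
  · refine forall_corner₁ (P := fun z => 0 ≤ coord m (-m) z) hm2 hδ h1 ?_ fun u hu => ?_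
    · rw [coord_centre₁ hm0, h0]
      exact mul_nonneg hR hpos
    · rw [coord_add, coord_vector hm0, coord_centre₁ hm0, h0, ← mul_add]
      have h3 : -sn m (-m + 2 * u) ≤ sn m (m - 2) := by
        rw [← sn_add_two_mul hm0]
        unfold IsCornerIndex at hu
        refine sn_le hm0 ?_
        omega
      exact mul_nonneg hR (by linarith)
  by_cases h2 : j < m - m / 4
  · refine forall_corner₂ (P := fun z => 0 ≤ coord m (-m) z) hm2 hδ (by omega) h2 ?_ fun u hu => ?_
    · rw [coord_centre₂ hm0, h0]
      exact mul_nonneg hR (by linarith)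
    · rw [coord_sub, coord_vector hm0, coord_centre₂ hm0, h0, ← mul_sub]
      refine mul_nonneg hR ?_
      unfold IsCornerIndex at hu
      -- Here the second m-gon may have a vertex straight below its centre, at the full depth 1 in
      -- units of the circumradius. The greater height of the centre makes up for it: with t = `sn m
      -- 1`, the margin is 2 t (1 - t) ≥ 0. In the even cases u is odd and so differs from m, which
      -- leaves a smaller depth.
      by_cases hm1 : m % 4 = 1
      · have h3 : sn m (-m + 2 * u) ≤ 1 := Real.sin_le_one _
        rw [show (-m + 2 * (2 * (m / 4 : ℕ) + 1) : ℤ) = 1 by omega, sn_sub_two hm0]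
        have h4 : sn m 1 ≤ 1 := Real.sin_le_one _
        have h5 : 0 ≤ sn m 1 := sn_nonneg hm0 (by omega) (by omega)
        nlinarith
      · have h3 : sn m (-m + 2 * u) ≤ sn m (m - 2) := by
          refine sn_le hm0 ?_
          omega
        linarith
  · refine forall_corner₃ (P := fun z => 0 ≤ coord m (-m) z) hm2 hδ (by omega) hj ?_ fun u hu => ?_
    · rw [coord_centre₃ hm0, h0, hq']
      exact mul_nonneg hR (by linarith)
    · rw [coord_add, coord_vector hm0, coord_centre₃ hm0, h0, hq', ← mul_add]
      have h3 : -sn m (-m + 2 * u) ≤ sn m (m - 2) := by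
        rw [← sn_four_mul_sub hm0]
        unfold IsCornerIndex at hu
        refine sn_le hm0 ?_
        omega
      exact mul_nonneg hR (by linarith)

/-- The coordinate vanishes on the lower left side of the kite, in direction -π/(2m). The
displacement from `centre₁ m` to `centre₂ m` is parallel to that side, and no corner is deeper than
`sn m (m - 1)` circumradii below its centre. -/
theorem coord_one_sub_nonneg (hm3 : m % 4 = 3) (hδ : IsThueMorse (quarterBlock m) δ)
    (hj : j ≤ m) : ∀ w ∈ corners m, 0 ≤ coord m (1 - m) (edgeMap m δ j w) := by
  have hm0 : m ≠ 0 := by omega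
  have hm2 : 2 ≤ m := by omega
  have hR := (circumradius_pos hm2).le
  have h0 : -sn m (1 - m - 2) = sn m (m - 1) := by
    rw [← sn_add_two_mul hm0]
    congr 1
    ring
  have hpos : 0 ≤ sn m (m - 1) := sn_nonneg hm0 (by omega) (by omega)
  have hq : sn m (1 - m + 2 * (2 * (m / 4 : ℕ) + 1)) = 0 := by
    rw [show (1 - m + 2 * (2 * (m / 4 : ℕ) + 1) : ℤ) = 0 by omega, sn_zero]
  have hq' : 0 ≤ sn m (2 * (2 * (m / 4 : ℕ) + 1) - (1 - m)) := sn_nonneg hm0 (by omega) (by omega)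
  by_cases h1 : j ≤ m / 4
  · refine forall_corner₁ (P := fun z => 0 ≤ coord m (1 - m) z) hm2 hδ h1 ?_ fun u hu => ?_
    · rw [coord_centre₁ hm0, h0]
      exact mul_nonneg hR hpos
    · rw [coord_add, coord_vector hm0, coord_centre₁ hm0, h0, ← mul_add]
      have h3 : -sn m (1 - m + 2 * u) ≤ sn m (m - 1) := by
        rw [← sn_add_two_mul hm0]
        unfold IsCornerIndex at hu
        refine sn_le hm0 ?_
        omega
      exact mul_nonneg hR (by linarith)
  by_cases h2 : j < m - m / 4
  · refine forall_corner₂ (P := fun z => 0 ≤ coord m (1 - m) z) hm2 hδ (by omega) h2 ?_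
      fun u hu => ?_
    · rw [coord_centre₂ hm0, h0, hq]
      exact mul_nonneg hR (by linarith)
    · rw [coord_sub, coord_vector hm0, coord_centre₂ hm0, h0, hq, ← mul_sub]
      have h3 : sn m (1 - m + 2 * u) ≤ sn m (m - 1) := by
        unfold IsCornerIndex at hu
        refine sn_le hm0 ?_
        omega
      exact mul_nonneg hR (by linarith)
  · refine forall_corner₃ (P := fun z => 0 ≤ coord m (1 - m) z) hm2 hδ (by omega) hj ?_
      fun u hu => ?_
    · rw [coord_centre₃ hm0, h0, hq]
      exact mul_nonneg hR (by linarith)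
    · rw [coord_add, coord_vector hm0, coord_centre₃ hm0, h0, hq, ← mul_add]
      have h3 : -sn m (1 - m + 2 * u) ≤ sn m (m - 1) := by
        rw [← sn_four_mul_sub hm0]
        unfold IsCornerIndex at hu
        refine sn_le hm0 ?_
        omega
      exact mul_nonneg hR (by linarith)

end Corners

/-! ### The open set condition -/

section OpenSet

variable {m : ℕ} {δ : ℕ → ℤˣ}

/-- The barycentric coordinate at the apex c is the ratio of heights; since c lies above or below
1/2, half of it is subtracted at each end of the base. -/
theorem mem_convexHull_of_triangle {W : Set ℂ} (h0 : (0 : ℂ) ∈ W) (h1 : (1 : ℂ) ∈ W) {c : ℂ}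
    (hc : c ∈ W) (hre : c.re = 1 / 2) (him : c.im ≠ 0) {z : ℂ} (hz0 : 0 ≤ z.im / c.im)
    (hz1 : z.im / c.im / 2 ≤ z.re) (hz2 : z.im / c.im / 2 ≤ 1 - z.re) : z ∈ convexHull ℝ W := by
  set l := z.im / c.im with hl
  have h := (convex_convexHull ℝ W).sum_mem (t := Finset.univ)
    (w := ![1 - z.re - l / 2, z.re - l / 2, l]) (z := ![0, 1, c])
    (by
      intro i _
      fin_cases i
      · simpa using hz2
      · simpa using hz1
      · simpa using hz0)
    (by
      rw [Fin.sum_univ_three]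
      simp
      ring)
    (by
      intro i _
      fin_cases i
      · exact subset_convexHull ℝ W h0
      · exact subset_convexHull ℝ W h1
      · exact subset_convexHull ℝ W hc)
  rw [Fin.sum_univ_three] at h
  convert h using 1
  apply Complex.ext
  · simp [hre]
    ring
  · simp [hl, him]

theorem centre₁_re (hm : 2 ≤ m) : (centre₁ m).re = 1 / 2 := by
  have h : (centre₁ m).re = coord m 0 (centre₁ m) := by rw [coord, dir_zero, one_mul]
  rw [h, coord_centre₁ (by omega), zero_sub, sn_neg, neg_neg, circumradius_mul_sn hm]

theorem centre₁_im (m : ℕ) : (centre₁ m).im = circumradius m * sn m (m - 2) := by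
  rw [centre₁, Complex.im_ofReal_mul, dir_im]

theorem dir_neg_self (hm : m ≠ 0) : dir m (-m) = -Complex.I := by
  rw [dir_neg, dir_self hm, Complex.conj_I]

theorem bottom_re (hm : 2 ≤ m) : (centre₁ m + circumradius m * dir m (-m)).re = 1 / 2 := by
  rw [Complex.add_re, centre₁_re hm, Complex.re_ofReal_mul, dir_neg_self (by omega)]
  simp

theorem bottom_im (hm : m ≠ 0) : (centre₁ m + circumradius m * dir m (-m)).im =
    -(2 * circumradius m * sn m 1 ^ 2) := by
  rw [Complex.add_im, centre₁_im, Complex.im_ofReal_mul, dir_neg_self hm, sn_sub_two hm]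
  simp
  ring

theorem coord_eq (hm : m ≠ 0) (n : ℤ) (z : ℂ) :
    coord m n z = sn m (n + m) * z.re - sn m n * z.im := by
  rw [coord, Complex.mul_re, dir_re hm, dir_im]

theorem sn_two (hm : m ≠ 0) : sn m 2 = 2 * sn m 1 * sn m (m - 1) := by
  have h3 : dir m 2 = dir m 1 * dir m 1 := by
    rw [← dir_add]
    rfl
  have h4 : sn m (1 + m) = sn m (m - 1) := by
    rw [← sn_two_mul_sub hm]
    congr 1
    ring
  rw [← dir_im, h3, Complex.mul_im, dir_re hm, dir_im, h4]
  ring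

/-- The direction of the lower left side of the kite. -/
def lowerIndex (m : ℕ) : ℤ := if m % 4 = 3 then 1 - m else -m

theorem mem_convexHull_corners_of_im_nonneg (hm : 3 ≤ m) {z : ℂ} (hz : 0 ≤ z.im)
    (h1 : sn m 2 * z.im ≤ sn m (m - 2) * z.re) (h2 : sn m 2 * z.im ≤ sn m (m - 2) * (1 - z.re)) :
    z ∈ convexHull ℝ (corners m) := by
  have hm0 : m ≠ 0 := by omega
  have hR := circumradius_pos (by omega : 2 ≤ m)
  have hRs := circumradius_mul_sn (by omega : 2 ≤ m)
  have hs : 0 < sn m (m - 2) := sn_pos hm0 (by omega) (by omega)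
  have him := centre₁_im m
  have hpos : 0 < (centre₁ m).im := by rw [him]; positivity
  have hhalf : z.im / (centre₁ m).im / 2 = sn m 2 * z.im / sn m (m - 2) := by
    rw [him, div_div, div_eq_div_iff (by positivity) hs.ne']
    linear_combination (-2 * z.im * sn m (m - 2)) * hRs
  refine mem_convexHull_of_triangle (Or.inl rfl) (Or.inr (Or.inl rfl))
    (Or.inr (Or.inr (Or.inl rfl))) (centre₁_re (by omega)) hpos.ne' (by positivity) ?_ ?_
  · rw [hhalf, div_le_iff₀ hs]
    linarith
  · rw [hhalf, div_le_iff₀ hs]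
    linarith

/-- The map z ↦ 1 - conj z is the reflection in Re z = 1/2, so only the two sides through 0 and
their mirror images have to be tested. The sides through 0 give homogeneous conditions, which
survive scaling by 1 / x. -/
theorem mem_convexHull_corners (hm : 3 ≤ m) {z : ℂ} (h1 : 0 ≤ coord m 2 z)
    (h2 : 0 ≤ coord m 2 (1 - (starRingEnd ℂ) z)) (h3 : 0 ≤ coord m (lowerIndex m) z)
    (h4 : 0 ≤ coord m (lowerIndex m) (1 - (starRingEnd ℂ) z)) : z ∈ convexHull ℝ (corners m) := by
  have hm0 : m ≠ 0 := by omega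
  have hm2 : 2 ≤ m := by omega
  have hrefl : (1 - (starRingEnd ℂ) z).re = 1 - z.re ∧ (1 - (starRingEnd ℂ) z).im = z.im := by
    constructor <;> simp
  have hs2 : sn m (2 + m) = sn m (m - 2) := by
    rw [← sn_two_mul_sub hm0]
    congr 1
    ring
  rw [coord_eq hm0, hs2] at h1 h2
  rw [coord_eq hm0] at h3 h4
  rw [hrefl.1, hrefl.2] at h2 h4
  by_cases hz : 0 ≤ z.im
  · exact mem_convexHull_corners_of_im_nonneg hm hz (by linarith) (by linarith)
  · rw [lowerIndex] at h3 h4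
    split_ifs at h3 h4 with hm3
    · have hn : sn m (1 - m) = -sn m (m - 1) := by
        rw [← sn_neg]
        congr 1
        ring
      rw [sub_add_cancel, hn] at h3 h4
      have hs1 : 0 < sn m 1 := sn_pos hm0 (by omega) (by omega)
      have hsm : 0 < sn m (m - 1) := sn_pos hm0 (by omega) (by omega)
      have hR := circumradius_pos hm2
      have hRs := circumradius_mul_sn hm2
      rw [sn_two hm0] at hRs
      have him := bottom_im (m := m) hm0
      set b := centre₁ m + circumradius m * dir m (-m) with hb
      have hneg : b.im < 0 := by
        rw [him]
        exact neg_lt_zero.2 (by positivity)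
      have hhalf : z.im / b.im / 2 = -(sn m (m - 1) * z.im) / sn m 1 := by
        rw [div_div, div_eq_div_iff (by linarith) hs1.ne', him]
        linear_combination (-2 * z.im * sn m 1) * hRs
      refine mem_convexHull_of_triangle (Or.inl rfl) (Or.inr (Or.inl rfl))
        (Or.inr (Or.inr (Or.inr ⟨hm3, hb⟩))) (bottom_re hm2) hneg.ne
        (div_nonneg_of_nonpos (not_le.1 hz).le hneg.le) ?_ ?_
      · rw [hhalf, div_le_iff₀ hs1]
        linarith
      · rw [hhalf, div_le_iff₀ hs1]
        linarith
    · rw [neg_add_cancel, sn_zero, sn_neg, sn_self hm0] at h3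
      linarith

/-- The open kite. -/
def kite (m : ℕ) : Set ℂ := interior (convexHull ℝ (corners m))

theorem kite_nonempty (hm : 3 ≤ m) : (kite m).Nonempty := by
  have hm0 : m ≠ 0 := by omega
  have hs2 : 0 < sn m 2 := sn_pos hm0 (by omega) (by omega)
  have hs : 0 < sn m (m - 2) := sn_pos hm0 (by omega) (by omega)
  let U : Set ℂ := {z | 0 < z.im ∧ sn m 2 * z.im < sn m (m - 2) * z.re ∧
    sn m 2 * z.im < sn m (m - 2) * (1 - z.re)}
  have hU : IsOpen U := by
    have hU1 : IsOpen {z : ℂ | 0 < z.im} := isOpen_lt continuous_const Complex.continuous_im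
    have hU2 : IsOpen {z : ℂ | sn m 2 * z.im < sn m (m - 2) * z.re} :=
      isOpen_lt (by fun_prop) (by fun_prop)
    have hU3 : IsOpen {z : ℂ | sn m 2 * z.im < sn m (m - 2) * (1 - z.re)} :=
      isOpen_lt (by fun_prop) (by fun_prop)
    exact hU1.inter (hU2.inter hU3)
  have hsub : U ⊆ convexHull ℝ (corners m) := fun z hz =>
    mem_convexHull_corners_of_im_nonneg hm hz.1.le hz.2.1.le hz.2.2.le
  refine ⟨⟨1 / 2, sn m (m - 2) / (4 * sn m 2)⟩, interior_maximal hsub hU ⟨?_, ?_, ?_⟩⟩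
  · change 0 < sn m (m - 2) / (4 * sn m 2)
    positivity
  · change sn m 2 * (sn m (m - 2) / (4 * sn m 2)) < sn m (m - 2) * (1 / 2)
    have : sn m 2 * (sn m (m - 2) / (4 * sn m 2)) = sn m (m - 2) / 4 := by field_simp
    linarith
  · change sn m 2 * (sn m (m - 2) / (4 * sn m 2)) < sn m (m - 2) * (1 - 1 / 2)
    have : sn m 2 * (sn m (m - 2) / (4 * sn m 2)) = sn m (m - 2) / 4 := by field_simp
    linarith

theorem isBounded_kite (m : ℕ) : Bornology.IsBounded (kite m) := by
  refine Bornology.IsBounded.subset ?_ interior_subset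
  refine isBounded_convexHull.2 (Set.Finite.isBounded ?_)
  refine Set.Finite.subset (Set.toFinite
    {0, 1, centre₁ m, centre₁ m + circumradius m * dir m (-m)}) ?_
  rintro w (rfl | rfl | rfl | ⟨-, rfl⟩) <;> simp

theorem one_sub_conj_mem_corners (hm : 2 ≤ m) {w : ℂ} (hw : w ∈ corners m) :
    1 - (starRingEnd ℂ) w ∈ corners m := by
  have hsymm : ∀ c : ℂ, c.re = 1 / 2 → 1 - (starRingEnd ℂ) c = c := by
    intro c hc
    apply Complex.ext
    · simp [hc]
      norm_num
    · simp
  rcases hw with rfl | rfl | rfl | ⟨h, rfl⟩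
  · exact Or.inr (Or.inl (by simp))
  · exact Or.inl (by simp)
  · exact Or.inr (Or.inr (Or.inl (hsymm _ (centre₁_re hm))))
  · exact Or.inr (Or.inr (Or.inr ⟨h, hsymm _ (bottom_re hm)⟩))

/-- The symmetry of the polygonal line exchanges the edges j and m - j. It carries the bounds at the
left end of the kite over to the right end. -/
theorem edgeMap_one_sub_conj (hm : m ≠ 0) (hδ : IsThueMorse (quarterBlock m) δ) {j : ℕ}
    (hj : j ≤ m) (w : ℂ) :
    edgeMap m δ (m - j) (1 - (starRingEnd ℂ) w) =
      p m δ (m + 1) - (starRingEnd ℂ) (edgeMap m δ j w) := by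
  have h1 := conj_p hm hδ (by omega : j + 1 ≤ m + 1)
  rw [show m + 1 - (j + 1) = m - j by omega, p_succ, map_add, conj_step hm hδ hj] at h1
  rw [edgeMap, edgeMap, map_add, map_mul, conj_step hm hδ hj]
  linear_combination h1

theorem coord_lowerIndex_nonneg (hm : 3 ≤ m) (hδ : IsThueMorse (quarterBlock m) δ) {j : ℕ}
    (hj : j ≤ m) : ∀ w ∈ corners m, 0 ≤ coord m (lowerIndex m) (edgeMap m δ j w) := by
  rw [lowerIndex]
  split_ifs with h
  · exact coord_one_sub_nonneg h hδ hj
  · exact coord_neg_nonneg hm h hδ hj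

theorem ifs_mem_convexHull (hm : 3 ≤ m) (hδ : IsThueMorse (quarterBlock m) δ) {x : ℝ}
    (hx : p m δ (m + 1) = x) (hx3 : 3 ≤ x) (j : Fin (m + 1)) {w : ℂ} (hw : w ∈ corners m) :
    ifs m δ j w ∈ convexHull ℝ (corners m) := by
  have hm0 : m ≠ 0 := by omega
  have hj : (j : ℕ) ≤ m := Nat.lt_succ_iff.1 j.2
  have hx0 : 0 < x := by linarith
  have hxc : (x : ℂ) ≠ 0 := Complex.ofReal_ne_zero.2 hx0.ne'
  have h1 : ifs m δ j w = (x⁻¹ : ℝ) * edgeMap m δ j w := by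
    rw [ifs, hx, ← edgeMap, div_eq_inv_mul, Complex.ofReal_inv]
  have h2 : 1 - (starRingEnd ℂ) (ifs m δ j w) =
      (x⁻¹ : ℝ) * edgeMap m δ (m - j) (1 - (starRingEnd ℂ) w) := by
    rw [edgeMap_one_sub_conj hm0 hδ hj, h1, map_mul, Complex.conj_ofReal, hx, mul_sub,
      Complex.ofReal_inv, inv_mul_cancel₀ hxc]
  have hw' := one_sub_conj_mem_corners (by omega) hw
  have hpos : 0 ≤ x⁻¹ := by positivity
  refine mem_convexHull_corners hm ?_ ?_ ?_ ?_
  · rw [h1, coord_real_mul]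
    exact mul_nonneg hpos (coord_two_nonneg hm hδ hj w hw)
  · rw [h2, coord_real_mul]
    exact mul_nonneg hpos (coord_two_nonneg hm hδ (by omega) _ hw')
  · rw [h1, coord_real_mul]
    exact mul_nonneg hpos (coord_lowerIndex_nonneg hm hδ hj w hw)
  · rw [h2, coord_real_mul]
    exact mul_nonneg hpos (coord_lowerIndex_nonneg hm hδ (by omega) _ hw')

theorem isOpenMap_affine {s y : ℂ} (hs : s ≠ 0) (t : ℂ) (hy : y ≠ 0) :
    IsOpenMap fun z : ℂ => (t + s * z) / y := by
  have h : (fun z : ℂ => (t + s * z) / y) =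
      ((Homeomorph.mulLeft₀ s hs).trans ((Homeomorph.addLeft t).trans
        (Homeomorph.mulRight₀ y⁻¹ (inv_ne_zero hy)))) := by
    funext z
    simp [div_eq_mul_inv]
  rw [h]
  exact Homeomorph.isOpenMap _

/-- Half-planes pull back to convex sets, so bounds checked at the corners hold on the whole convex
hull. -/
theorem convex_affine_re (P : ℝ → Prop) (hP : Convex ℝ {r | P r}) (c s t : ℂ) :
    Convex ℝ {z : ℂ | P (c * (t + s * z)).re} := by
  intro z hz w hw a b ha hb hab
  have h := hP hz hw ha hb hab
  have heq : (c * (t + s * (a • z + b • w))).re =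
      a • (c * (t + s * z)).re + b • (c * (t + s * w)).re := by
    have h1 : c * (t + s * (a • z + b • w)) =
        (a : ℂ) * (c * (t + s * z)) + (b : ℂ) * (c * (t + s * w)) := by
      have hab' : (a : ℂ) + b = 1 := by exact_mod_cast hab
      simp only [Complex.real_smul]
      linear_combination (-(c * t)) * hab'
    rw [h1, Complex.add_re, Complex.re_ofReal_mul, Complex.re_ofReal_mul, smul_eq_mul, smul_eq_mul]
  change P _
  rw [heq]
  exact h

theorem disjoint_of_separation {x : ℝ} (hx : p m δ (m + 1) = x) (hx0 : x ≠ 0) {i k : Fin (m + 1)}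
    {n : ℤ} {κ : ℝ} (hi : ∀ w ∈ corners m, coord m n (edgeMap m δ i w) ≤ κ)
    (hk : ∀ w ∈ corners m, κ ≤ coord m n (edgeMap m δ k w)) :
    Disjoint (ifs m δ i '' kite m) (ifs m δ k '' kite m) := by
  have hi' : ∀ z ∈ kite m, coord m n (edgeMap m δ i z) ≤ κ := fun z hz =>
    convexHull_min (s := corners m) (t := {z | coord m n (edgeMap m δ i z) ≤ κ}) hi
      (convex_affine_re (· ≤ κ) (convex_Iic κ) _ _ _) (interior_subset hz)
  have hk' : ∀ z ∈ kite m, κ ≤ coord m n (edgeMap m δ k z) := fun z hz =>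
    convexHull_min (s := corners m) (t := {z | κ ≤ coord m n (edgeMap m δ k z)}) hk
      (convex_affine_re (κ ≤ ·) (convex_Ici κ) _ _ _) (interior_subset hz)
  rw [Set.disjoint_left]
  rintro _ ⟨v, hv, rfl⟩ ⟨v', hv', hvv'⟩
  have hxc : (x : ℂ) ≠ 0 := Complex.ofReal_ne_zero.2 hx0
  have heq : edgeMap m δ k v' = edgeMap m δ i v := by
    rw [ifs, ifs, hx, div_left_inj' hxc] at hvv'
    exact hvv'
  have hs := step_ne_zero m δ i
  have hκ : κ ≤ coord m n (edgeMap m δ i v) := heq ▸ hk' v' hv'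
  -- A common point of the images would lie on the separating line. As the kite is open, v can be
  -- moved slightly so that its image crosses the line, against `hi'`.
  have hmove : ∀ t : ℝ, coord m n (edgeMap m δ i (v + t * (dir m (-n) / step m δ i))) =
      coord m n (edgeMap m δ i v) + t := by
    intro t
    have h1 : edgeMap m δ i (v + t * (dir m (-n) / step m δ i)) =
        edgeMap m δ i v + t * dir m (-n) := by
      rw [edgeMap, edgeMap]
      field_simp
      ring
    have h2 : coord m n (dir m (-n)) = 1 := by
      rw [coord, ← dir_add, add_neg_cancel, dir_zero, Complex.one_re]
    rw [h1, coord_add, coord_real_mul, h2, mul_one]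
  have hlim : Tendsto (fun t : ℝ => v + t * (dir m (-n) / step m δ i)) (𝓝[>] 0) (𝓝 v) := by
    have hcont : Continuous fun t : ℝ => v + t * (dir m (-n) / step m δ i) := by fun_prop
    have h := hcont.tendsto 0
    simp only [Complex.ofReal_zero, zero_mul, add_zero] at h
    exact h.mono_left nhdsWithin_le_nhds
  obtain ⟨t, ht, ht0⟩ :=
    ((hlim.eventually (isOpen_interior.mem_nhds hv)).and self_mem_nhdsWithin).exists
  have h1 := hi' _ ht
  rw [hmove] at h1
  have : (0 : ℝ) < t := ht0
  linarith

theorem kite_disjoint (hm : 3 ≤ m) (hδ : IsThueMorse (quarterBlock m) δ) {x : ℝ}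
    (hx : p m δ (m + 1) = x) (hx3 : 3 ≤ x) {i k : Fin (m + 1)} (hik : i < k) :
    Disjoint (ifs m δ i '' kite m) (ifs m δ k '' kite m) := by
  have hx0 : x ≠ 0 := by linarith
  have hk : (k : ℕ) ≤ m := Nat.lt_succ_iff.1 k.2
  have hik' : (i : ℕ) < k := hik
  by_cases harc : (i : ℕ) ≤ m / 4 ∧ m / 4 < (k : ℕ) ∨ (i : ℕ) < m - m / 4 ∧ m - m / 4 ≤ (k : ℕ)
  · obtain ⟨n, κ, h1, h2⟩ := exists_separation_other_arc (by omega) hδ hk harc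
    exact disjoint_of_separation hx hx0 h1 h2
  · obtain ⟨n, κ, ⟨h1, h2⟩ | ⟨h1, h2⟩⟩ :=
      exists_separation_same_arc (by omega) hδ hik' hk (by omega)
    · exact disjoint_of_separation hx hx0 h1 h2
    · exact (disjoint_of_separation hx hx0 h2 h1).symm

theorem openSetCondition_of_three_le (hm : 3 ≤ m) (hδ : IsThueMorse (quarterBlock m) δ) {x : ℝ}
    (hx : p m δ (m + 1) = x) (hx3 : 3 ≤ x) : OpenSetCondition (ifs m δ) := by
  refine ⟨kite m, kite_nonempty hm, isBounded_kite m, isOpen_interior, ?_, ?_⟩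
  · refine Set.iUnion_subset fun j => ?_
    have hxc : p m δ (m + 1) ≠ 0 := by
      rw [hx]
      exact Complex.ofReal_ne_zero.2 (by linarith)
    -- An open image contained in the closed kite lies in its interior, so it suffices to control
    -- the corners.
    refine interior_maximal ?_
      (isOpenMap_affine (step_ne_zero m δ j) (p m δ j) hxc _ isOpen_interior)
    rintro _ ⟨z, hz, rfl⟩
    refine convexHull_min (s := corners m)
      (t := {z | ifs m δ j z ∈ convexHull ℝ (corners m)})
      (fun w hw => ifs_mem_convexHull hm hδ hx hx3 j hw) ?_ (interior_subset hz)
    intro z hz w hw a b ha hb hab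
    have h := convex_convexHull ℝ (corners m) hz hw ha hb hab
    have heq : ifs m δ j (a • z + b • w) = a • ifs m δ j z + b • ifs m δ j w := by
      have hab' : (a : ℂ) + b = 1 := by exact_mod_cast hab
      simp only [Complex.real_smul, ifs]
      field_simp
      linear_combination (-(p m δ j)) * hab'
    change ifs m δ j _ ∈ convexHull ℝ (corners m)
    rw [heq]
    exact h
  · intro i k hik
    rcases hik.lt_or_gt with h | h
    · exact kite_disjoint hm hδ hx hx3 h
    · exact (kite_disjoint hm hδ hx hx3 h).symm

/-! ### The degenerate case m = 2 -/

theorem step_two (hδ : IsThueMorse (quarterBlock 2) δ) {k : ℕ} (hk : k ≤ 2) : step 2 δ k = 1 := by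
  have h4 : dir 2 4 = -1 := dir_two_mul two_ne_zero
  have h8 : dir 2 8 = 1 := by
    rw [show (8 : ℤ) = 4 + 4 by norm_num, dir_add, h4]
    norm_num
  rw [step_eq two_ne_zero hδ hk]
  interval_cases k
  · simp [dir_zero]
  · simp [h4]
  · simp [h8]

theorem p_two (hδ : IsThueMorse (quarterBlock 2) δ) {k : ℕ} (hk : k ≤ 3) : p 2 δ k = k := by
  induction k with
  | zero => simp [p_zero]
  | succ k ih =>
    rw [p_succ, ih (by omega), step_two hδ (by omega)]
    push_cast
    ring

/-- All three steps are 1, so the maps divide the unit interval into thirds, and any open rectangle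
over it that is symmetric about the real axis will do. -/
theorem openSetCondition_two (hδ : IsThueMorse (quarterBlock 2) δ) :
    OpenSetCondition (ifs 2 δ) := by
  have hifs : ∀ (j : Fin 3) (z : ℂ), ifs 2 δ j z = ((j : ℕ) + z) / 3 := by
    intro j z
    rw [ifs, p_two hδ le_rfl, p_two hδ (by omega), step_two hδ (by omega), one_mul]
    norm_num
  have hre : ∀ (j : Fin 3) (z : ℂ), (ifs 2 δ j z).re = ((j : ℕ) + z.re) / 3 := by
    intro j z
    rw [hifs]
    simp
  have him : ∀ (j : Fin 3) (z : ℂ), (ifs 2 δ j z).im = z.im / 3 := by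
    intro j z
    rw [hifs]
    simp
  refine ⟨Set.Ioo 0 1 ×ℂ Set.Ioo (-1) 1, ⟨⟨1 / 2, 0⟩, by
    constructor <;> norm_num⟩, (isBounded_Ioo 0 1).reProdIm (isBounded_Ioo (-1) 1),
    isOpen_Ioo.reProdIm isOpen_Ioo, ?_, ?_⟩
  · refine Set.iUnion_subset fun j => ?_
    rintro _ ⟨z, ⟨⟨h1, h2⟩, ⟨h3, h4⟩⟩, rfl⟩
    have hj : ((j : ℕ) : ℝ) ≤ 2 := by exact_mod_cast Nat.lt_succ_iff.1 j.2
    have hj0 : (0 : ℝ) ≤ ((j : ℕ) : ℝ) := Nat.cast_nonneg _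
    refine ⟨?_, ?_⟩
    · change (ifs 2 δ j z).re ∈ Set.Ioo (0 : ℝ) 1
      rw [hre]
      constructor <;> linarith
    · change (ifs 2 δ j z).im ∈ Set.Ioo (-1 : ℝ) 1
      rw [him]
      constructor <;> linarith
  · intro i j hij
    rw [Set.disjoint_left]
    rintro _ ⟨z, ⟨⟨h1, h2⟩, -⟩, rfl⟩ ⟨w, ⟨⟨h3, h4⟩, -⟩, heq⟩
    have h := congrArg Complex.re heq
    rw [hre, hre] at h
    rcases hij.lt_or_gt with hlt | hlt
    · have : ((i : ℕ) : ℝ) + 1 ≤ ((j : ℕ) : ℝ) := by exact_mod_cast hlt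
      linarith
    · have : ((j : ℕ) : ℝ) + 1 ≤ ((i : ℕ) : ℝ) := by exact_mod_cast hlt
      linarith

theorem openSetCondition_ifs (hm : 2 ≤ m) (hδ : IsThueMorse (quarterBlock m) δ) {x : ℝ}
    (hx : p m δ (m + 1) = x) (hx3 : 3 ≤ x) : OpenSetCondition (ifs m δ) := by
  rcases hm.eq_or_lt with rfl | h
  · exact openSetCondition_two hδ
  · exact openSetCondition_of_three_le h hδ hx hx3

end OpenSet

end KochCurve

theorem corollary1p2 (m : ℕ) (hm : 2 ≤ m) (δ : ℕ → ℤˣ)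
    (hδ : KochCurve.IsThueMorse (KochCurve.quarterBlock m) δ) :
    ∃ x : ℝ, KochCurve.p m δ (m + 1) = (x : ℂ) ∧ 3 ≤ x ∧ x ≤ (m : ℝ) + 1 ∧
      KochCurve.OpenSetCondition (KochCurve.ifs m δ) ∧
      ∃ K : Set ℂ, KochCurve.IsKochCurve m δ K ∧
        (∀ K' : Set ℂ, KochCurve.IsKochCurve m δ K' → K' = K) ∧
        dimH K = ENNReal.ofReal (Real.log ((m : ℝ) + 1) / Real.log x) ∧
        KochCurve.packingDim K = ENNReal.ofReal (Real.log ((m : ℝ) + 1) / Real.log x) ∧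
        KochCurve.HasBoxDim K (Real.log ((m : ℝ) + 1) / Real.log x) := by
  have hm0 : m ≠ 0 := by omega
  obtain ⟨x, hx, hx3, hxm⟩ := KochCurve.exists_real_p hm hδ
  have hosc := KochCurve.openSetCondition_ifs hm hδ hx hx3
  have hK := KochCurve.isKochCurve_limitSet hm0 hδ hx hx3
  obtain ⟨c, C, hreg⟩ := KochCurve.isAhlforsRegular_naturalMeasure hm0 hδ hx hx3 hosc
  exact ⟨x, hx, hx3, hxm, hosc, _, hK, fun K' hK' => hK.eq hK',
    le_antisymm (hreg.dimH_le hK.2.1) hreg.dimH_ge, hreg.packingDim_eq hK.2.1,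
    hreg.hasBoxDim hK.2.1⟩
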